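/- A \emph{polygon} is a compact region of the Euclidean plane enclosed by a simple closed polygonal chain. An \emph{inside-out dissection} of a polygon $P$ is a decomposition of $P$ into finitely many polygons $P_1,\dots,P_k$ (the pieces) with pairwise disjoint interiors such that (1) the pieces can be rearranged, without overlaps of their interiors and using only rotations and translations, to form a polygon $P'$ congruent to $P$, and (2) the boundary of $P'$ is composed of internal cuts of $P$, that is, it is covered by the moved copies of the closed parts $\overline{\partial P_i\cap\operatorname{int}P}$ of the boundaries of the pieces. \textbf{Lemma.} For every $n\ge 3$, every regular $n$-gon $P$ can be inside-out dissected with at most $6$ pieces. -/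

import Mathlib

/-! The Euclidean plane is modelled by `ℂ`; closed polygonal chains are Mathlib's `Polygon ℂ n`. -/

/-- A closed polygonal chain is simple if it does not meet itself: the points of its half-open
edges (start point included, end point excluded) are pairwise distinct. -/
def Polygon.IsSimple {n : ℕ} (γ : Polygon ℂ n) : Prop :=
  Function.Injective fun p : Fin n × Set.Ico (0 : ℝ) 1 => γ.edgePath ℝ p.1 (p.2 : ℝ)

/-- `A` is a polygon (as a region of the plane): the compact region enclosed by a simple closed
polygonal chain. A compact set whose topological boundary is such a chain is, by the Jordan curve
theorem, either the chain itself or the closed region that it encloses; the condition on the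
interior leaves the second. -/
structure IsPolygonalRegion (A : Set ℂ) : Prop where
  isCompact : IsCompact A
  interior_nonempty : (interior A).Nonempty
  exists_boundary : ∃ (n : ℕ) (γ : Polygon ℂ n),
    3 ≤ n ∧ γ.IsSimple ∧ frontier A = γ.boundary ℝ

/-- `A` is a regular `n`-gon: the convex hull of `n` points equally spaced on a circle of positive
radius (`c` is the centre and `c + w` one of the vertices). -/
def IsRegularPolygon (n : ℕ) (A : Set ℂ) : Prop :=
  3 ≤ n ∧ ∃ c w : ℂ, w ≠ 0 ∧
    A = convexHull ℝ (Set.range fun j : Fin n =>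
      c + w * Complex.exp (2 * Real.pi * Complex.I * ((j : ℕ) : ℂ) / (n : ℂ)))

/-- The sets `Q i` fill `A` without overlap: they cover exactly `A`, and their interiors are
pairwise disjoint. -/
structure IsTiledBy {k : ℕ} (A : Set ℂ) (Q : Fin k → Set ℂ) : Prop where
  iUnion_eq : ⋃ i, Q i = A
  disjoint_interior : Pairwise fun i j => Disjoint (interior (Q i)) (interior (Q j))

/-- The proper rigid motion of the plane that rotates by `a` about the origin and then translates
by `b`. The compositions of rotations and translations are exactly these maps. -/
noncomputable def rigidMotion (a : Circle) (b : ℂ) (z : ℂ) : ℂ := rotation a z + b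

/-- The internal cuts of `P` along the piece `Q`: the part of the boundary of `Q` that runs
inside `P`, with its endpoints. -/
def internalCuts (P Q : Set ℂ) : Set ℂ := closure (frontier Q ∩ interior P)

/-- `(Q 0, …, Q (k - 1))` is an inside-out dissection of `P`: the `Q i` are polygons that decompose
`P`, and they can be rearranged by rotations and translations to form a set `P'` congruent to `P`
whose boundary is composed of (the moved copies of) internal cuts of `P`. -/
def IsInsideOutDissection {k : ℕ} (P : Set ℂ) (Q : Fin k → Set ℂ) : Prop :=
  (∀ i, IsPolygonalRegion (Q i)) ∧ IsTiledBy P Q ∧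
    ∃ (a : Fin k → Circle) (b : Fin k → ℂ) (P' : Set ℂ),
      (∃ h : ℂ ≃ᵢ ℂ, P' = h '' P) ∧
      IsTiledBy P' (fun i => rigidMotion (a i) (b i) '' Q i) ∧
      frontier P' ⊆ ⋃ i, rigidMotion (a i) (b i) '' internalCuts P (Q i)

/-!
Every piece of the dissections below is rotated onto itself, so that the rearranged polygon is the
original one, and what has to be seen is that the boundary of the polygon is covered by the rotated
internal cuts. This notion, `InsideOut.HasInPlaceDissection`, is invariant under similarities, so
it is enough to treat the polygon `InsideOut.unitPolygon n` with centre `0` and a vertex at `1`.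

For most `n` one works as follows. Divide the boundary of `P` into arcs, and let `S` be the point
reflection that exchanges the endpoints of an arc. The *lens* `P ∩ S P` of the arc is symmetric
under `S`, which is the rotation by `π` about its centre. If the arc turns by little enough, then
the reflected arc runs inside `P`, except for its endpoints (`IsArc.swap_bdry_mem_interior`), and
the lens lies in the sector spanned by the arc (`IsArc.mem_lens`). Hence the lens is a polygon whose
boundary consists of the arc and its reflection, and the rotation carries its internal cut, the
reflected arc, onto the arc. As the sectors are disjoint, the lenses do not overlap, and what
remains of `P` is one central polygon, whose boundary is the chain of the reflected arcs and which
stays where it is (`IsDivision.hasInPlaceDissection`). For `n = 5` and for `n ≥ 7` the boundary can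
be divided at vertices and midpoints of sides into five such arcs (`exists_isDivision`), which gives
six pieces.

Both properties of the lens rest on one fact of linear algebra, `height_pos_of_cone`: a nonzero
vector that points away from the normal of one side and towards the normal of another has a positive
component in every direction between the latter normal and the opposite of the former.

The remaining polygons have dissections of their own, checked in affine coordinates: the square
is divided into four squares and the regular hexagon into three rhombi, all rotated by `π`; the
equilateral triangle is divided into three rhombi at the corners, rotated by `π`, and three
triangles at the middles of the sides, rotated by `2 * π / 3`.

That the pieces are polygons follows from `exists_simple_polygon_of_curve`: a closed curve that is
affine between consecutive integers and injective on a period traces out a simple polygon.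
-/

namespace InsideOut

open Set

/-! ### Simple polygons from piecewise affine closed curves -/

/-- A closed curve that is affine on the `N` unit intervals following `s₀`, and injective apart from
the coincidence of its ends, is the boundary of a simple polygon with `N` vertices. -/
theorem exists_simple_polygon_of_curve {N : ℕ} (hN : 0 < N) (c : ℝ → ℂ) (s₀ : ℝ)
    (haff : ∀ j : ℕ, j < N → ∀ s ∈ Icc (0 : ℝ) 1,
      c (s₀ + j + s) = AffineMap.lineMap (c (s₀ + j)) (c (s₀ + j + 1)) s)
    (hper : c (s₀ + N) = c s₀) (hinj : InjOn c (Ico s₀ (s₀ + N))) :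
    ∃ γ : Polygon ℂ N, γ.IsSimple ∧ γ.boundary ℝ = c '' Icc s₀ (s₀ + N) := by
  obtain ⟨m, rfl⟩ : ∃ m, N = m + 1 := ⟨N - 1, by omega⟩
  have hrot : ∀ i : Fin (m + 1), c (s₀ + (finRotate (m + 1) i : Fin (m + 1)).val) =
      c (s₀ + i + 1) := by
    intro i
    by_cases hi : i = Fin.last m
    · subst hi
      rw [finRotate_last]
      simp only [Fin.val_zero, Nat.cast_zero, add_zero, Fin.val_last]
      rw [← hper]; congr 1; push_cast; ring
    · rw [coe_finRotate_of_ne_last hi]; congr 1; push_cast; ring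
  have hpath : ∀ (i : Fin (m + 1)) (s : ℝ), s ∈ Icc (0 : ℝ) 1 →
      Polygon.edgePath ℝ (⟨fun i => c (s₀ + i.val)⟩ : Polygon ℂ (m + 1)) i s = c
          (s₀ + i.val + s) := by
    intro i s hs
    rw [haff i i.2 s hs]
    simp only [Polygon.edgePath, hrot]
  refine ⟨⟨fun i => c (s₀ + i.val)⟩, ?_, ?_⟩
  · rintro ⟨i, s, hs⟩ ⟨i', s', hs'⟩ h
    simp only at h
    rw [hpath i s ⟨hs.1, hs.2.le⟩, hpath i' s' ⟨hs'.1, hs'.2.le⟩] at h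
    have hb : ∀ (i : Fin (m + 1)) (s : ℝ), s ∈ Ico (0 : ℝ) 1 →
        s₀ + i.val + s ∈ Ico s₀ (s₀ + (m + 1 : ℕ)) := by
      intro i s hs
      have h1 : ((i.val : ℝ)) + 1 ≤ (m + 1 : ℕ) := by exact_mod_cast i.2
      have h2 : (0 : ℝ) ≤ i.val := Nat.cast_nonneg _
      exact ⟨by linarith [hs.1], by linarith [hs.2]⟩
    have h3 := hinj (hb i s hs) (hb i' s' hs') h
    have h4 : (i.val : ℝ) + s = i'.val + s' := by linarith
    have h5 : i.val = i'.val := by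
      have e1 : ⌊(i.val : ℝ) + s⌋₊ = i.val := by
        rw [Nat.floor_eq_iff (by linarith [hs.1, Nat.cast_nonneg (α := ℝ) i.val])]
        exact ⟨by linarith [hs.1], by linarith [hs.2]⟩
      have e2 : ⌊(i'.val : ℝ) + s'⌋₊ = i'.val := by
        rw [Nat.floor_eq_iff (by linarith [hs'.1, Nat.cast_nonneg (α := ℝ) i'.val])]
        exact ⟨by linarith [hs'.1], by linarith [hs'.2]⟩
      rw [← e1, ← e2, h4]
    have h6 : i = i' := Fin.ext h5
    subst h6
    have h7 : s = s' := by linarith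
    subst h7
    rfl
  · ext z
    simp only [Polygon.boundary, Polygon.edgeSet_eq_image_edgePath, mem_iUnion, mem_image]
    constructor
    · rintro ⟨i, s, hs, rfl⟩
      rw [hpath i s hs]
      refine ⟨_, ?_, rfl⟩
      have h1 : ((i.val : ℝ)) + 1 ≤ (m + 1 : ℕ) := by exact_mod_cast i.2
      have h2 : (0 : ℝ) ≤ i.val := Nat.cast_nonneg _
      exact ⟨by linarith [hs.1], by linarith [hs.2]⟩
    · rintro ⟨t, ⟨ht0, ht1⟩, rfl⟩
      by_cases hlast : t = s₀ + (m + 1 : ℕ)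
      · refine ⟨Fin.last m, 1, by simp, ?_⟩
        rw [hpath _ _ (by simp), hlast]
        simp only [Fin.val_last]; congr 1; push_cast; ring
      · have hlt : t < s₀ + (m + 1 : ℕ) := lt_of_le_of_ne ht1 hlast
        have h0 : 0 ≤ t - s₀ := by linarith
        have hf : ⌊t - s₀⌋₊ < m + 1 := by
          rw [Nat.floor_lt h0]; linarith
        have h1 := Nat.floor_le h0
        have h2 := Nat.lt_floor_add_one (t - s₀)
        have hmem : t - s₀ - ⌊t - s₀⌋₊ ∈ Icc (0 : ℝ) 1 := ⟨by linarith, by linarith⟩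
        refine ⟨⟨⌊t - s₀⌋₊, hf⟩, t - s₀ - ⌊t - s₀⌋₊, hmem, ?_⟩
        rw [hpath _ _ hmem]
        congr 1; ring

/-! ### Affine frames, parallelograms and triangles -/

/-- Affine coordinates in the plane: `(x, y) ↦ p + x u + y v`. -/
noncomputable def frame (p u v : ℂ) (q : ℝ × ℝ) : ℂ := p + q.1 * u + q.2 * v

/-- The vectors `u` and `v` are linearly independent over `ℝ`. -/
def Indep (u v : ℂ) : Prop := u.re * v.im - u.im * v.re ≠ 0

/-- Affine coordinates with respect to independent vectors, as a homeomorphism. -/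
noncomputable def frameHomeo (p u v : ℂ) (h : Indep u v) : ℝ × ℝ ≃ₜ ℂ where
  toFun := frame p u v
  invFun z := (((z - p).re * v.im - (z - p).im * v.re) / (u.re * v.im - u.im * v.re),
    (u.re * (z - p).im - u.im * (z - p).re) / (u.re * v.im - u.im * v.re))
  left_inv q := by
    unfold Indep at h
    ext
    · simp only [frame, Complex.sub_re, Complex.add_re, Complex.mul_re, Complex.ofReal_re,
        Complex.ofReal_im, Complex.sub_im, Complex.add_im, Complex.mul_im]
      rw [div_eq_iff h]; ring
    · simp only [frame, Complex.sub_re, Complex.add_re, Complex.mul_re, Complex.ofReal_re,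
        Complex.ofReal_im, Complex.sub_im, Complex.add_im, Complex.mul_im]
      rw [div_eq_iff h]; ring
  right_inv z := by
    unfold Indep at h
    generalize hD : u.re * v.im - u.im * v.re = D at h ⊢
    apply Complex.ext
    · simp only [frame, Complex.sub_re, Complex.add_re, Complex.mul_re, Complex.ofReal_re,
        Complex.ofReal_im, Complex.sub_im]
      field_simp
      rw [← hD]; ring
    · simp only [frame, Complex.sub_re, Complex.ofReal_re,
        Complex.ofReal_im, Complex.sub_im, Complex.add_im, Complex.mul_im]
      field_simp
      rw [← hD]; ring
  continuous_toFun := by unfold frame; fun_prop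
  continuous_invFun := by fun_prop

theorem frameHomeo_coe (p u v : ℂ) (h : Indep u v) : ⇑(frameHomeo p u v h) = frame p u v := rfl

theorem frame_injective (p : ℂ) {u v : ℂ} (h : Indep u v) : Function.Injective (frame p u v) :=
  (frameHomeo p u v h).injective

theorem interior_frame_image (p : ℂ) {u v : ℂ} (h : Indep u v) (S : Set (ℝ × ℝ)) :
    interior (frame p u v '' S) = frame p u v '' interior S :=
  ((frameHomeo p u v h).image_interior S).symm

theorem frontier_frame_image (p : ℂ) {u v : ℂ} (h : Indep u v) (S : Set (ℝ × ℝ)) :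
    frontier (frame p u v '' S) = frame p u v '' frontier S :=
  ((frameHomeo p u v h).image_frontier S).symm

/-- The closed half-plane `α x + β y ≤ c`. -/
def halfPlane (α β c : ℝ) : Set (ℝ × ℝ) := {q | α * q.1 + β * q.2 ≤ c}

theorem isClosed_halfPlane (α β c : ℝ) : IsClosed (halfPlane α β c) :=
  isClosed_le (by fun_prop) continuous_const

theorem interior_halfPlane {α β : ℝ} (h : α ^ 2 + β ^ 2 ≠ 0) (c : ℝ) :
    interior (halfPlane α β c) = {q | α * q.1 + β * q.2 < c} := by
  let f : ℝ × ℝ →L[ℝ] ℝ := α • ContinuousLinearMap.fst ℝ ℝ ℝ + β • ContinuousLinearMap.snd ℝ ℝ ℝ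
  have hf : ∀ q, f q = α * q.1 + β * q.2 := fun q => by simp [f]
  have hsurj : Function.Surjective f := by
    intro y
    refine ⟨(y * α / (α ^ 2 + β ^ 2), y * β / (α ^ 2 + β ^ 2)), ?_⟩
    rw [hf]; field_simp
  have h1 : halfPlane α β c = f ⁻¹' Iic c := by ext q; simp [halfPlane, hf]
  rw [h1, ← (f.isOpenMap hsurj).preimage_interior_eq_interior_preimage f.continuous, interior_Iic]
  ext q; simp [hf]

/-- The parallelogram spanned by `u` and `v` at `p`. -/
def para (p u v : ℂ) : Set ℂ := frame p u v '' (Icc 0 1 ×ˢ Icc 0 1)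

/-- The triangle with vertices `p`, `p + u`, `p + v`. -/
def tri (p u v : ℂ) : Set ℂ := frame p u v '' {q | 0 ≤ q.1 ∧ 0 ≤ q.2 ∧ q.1 + q.2 ≤ 1}

theorem isPolygonalRegion_para (p : ℂ) {u v : ℂ} (h : Indep u v) :
    IsPolygonalRegion (para p u v) := by
  have hint : interior (Icc (0 : ℝ) 1 ×ˢ Icc (0 : ℝ) 1) = Ioo 0 1 ×ˢ Ioo 0 1 := by
    rw [interior_prod_eq, interior_Icc]
  let E : Fin 4 → ℝ → ℝ × ℝ :=
    ![fun s => (s, 0), fun s => (1, s), fun s => (1 - s, 1), fun s => (0, 1 - s)]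
  have hE : ∀ i s, Polygon.edgePath ℝ (⟨![p, p + u, p + u + v, p + v]⟩ : Polygon ℂ 4) i s
      = frame p u v (E i s) := by
    intro i s
    fin_cases i <;> simp [Polygon.edgePath, AffineMap.lineMap_apply, E, frame] <;> ring
  refine ⟨?_, ?_, 4, ⟨![p, p + u, p + u + v, p + v]⟩, by norm_num, ?_, ?_⟩
  · exact (isCompact_Icc.prod isCompact_Icc).image (frameHomeo p u v h).continuous
  · rw [para, interior_frame_image p h, hint]
    exact ⟨_, (1 / 2, 1 / 2), by norm_num [mem_prod], rfl⟩
  · rintro ⟨i, s, hs⟩ ⟨i', s', hs'⟩ hh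
    simp only [hE] at hh
    have h3 := frame_injective p h hh
    obtain ⟨h1, h2⟩ := hs
    obtain ⟨h1', h2'⟩ := hs'
    fin_cases i <;> fin_cases i' <;> simp [E] at h3 <;>
      first | (exfalso; linarith [h3.1, h3.2]) | (subst h3; rfl)
  · rw [para, frontier_frame_image p h, (isClosed_Icc.prod isClosed_Icc).frontier_eq, hint]
    ext z
    simp only [Polygon.boundary, Polygon.edgeSet_eq_image_edgePath, mem_iUnion, mem_image, hE]
    constructor
    · rintro ⟨⟨x, y⟩, ⟨⟨⟨hx0, hx1⟩, hy0, hy1⟩, hq⟩, rfl⟩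
      simp only at hx0 hx1 hy0 hy1
      simp only [mem_prod, mem_Ioo, not_and_or, not_lt] at hq
      rcases hq with (hq | hq) | (hq | hq)
      · exact ⟨3, 1 - y, ⟨by linarith, by linarith⟩, by simp [E]; congr; linarith⟩
      · exact ⟨1, y, ⟨by linarith, by linarith⟩, by simp [E]; congr; linarith⟩
      · exact ⟨0, x, ⟨by linarith, by linarith⟩, by simp [E]; congr; linarith⟩
      · exact ⟨2, 1 - x, ⟨by linarith, by linarith⟩, by simp [E]; congr; linarith⟩
    · rintro ⟨i, s, ⟨hs0, hs1⟩, rfl⟩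
      refine ⟨E i s, ?_, rfl⟩
      fin_cases i <;> simp [E, hs0, hs1]

theorem setOf_simplex_eq : {q : ℝ × ℝ | 0 ≤ q.1 ∧ 0 ≤ q.2 ∧ q.1 + q.2 ≤ 1} =
    halfPlane (-1) 0 0 ∩ (halfPlane 0 (-1) 0 ∩ halfPlane 1 1 1) := by
  ext q; simp [halfPlane]

theorem interior_simplex : interior {q : ℝ × ℝ | 0 ≤ q.1 ∧ 0 ≤ q.2 ∧ q.1 + q.2 ≤ 1} =
    {q : ℝ × ℝ | 0 < q.1 ∧ 0 < q.2 ∧ q.1 + q.2 < 1} := by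
  rw [setOf_simplex_eq, interior_inter, interior_inter, interior_halfPlane (by norm_num),
    interior_halfPlane (by norm_num), interior_halfPlane (by norm_num)]
  ext q; simp

theorem isClosed_simplex : IsClosed {q : ℝ × ℝ | 0 ≤ q.1 ∧ 0 ≤ q.2 ∧ q.1 + q.2 ≤ 1} := by
  rw [setOf_simplex_eq]
  exact (isClosed_halfPlane _ _ _).inter ((isClosed_halfPlane _ _ _).inter
    (isClosed_halfPlane _ _ _))

theorem isPolygonalRegion_tri (p : ℂ) {u v : ℂ} (h : Indep u v) :
    IsPolygonalRegion (tri p u v) := by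
  let E : Fin 3 → ℝ → ℝ × ℝ := ![fun s => (s, 0), fun s => (1 - s, s), fun s => (0, 1 - s)]
  have hE : ∀ i s, Polygon.edgePath ℝ (⟨![p, p + u, p + v]⟩ : Polygon ℂ 3) i s
      = frame p u v (E i s) := by
    intro i s
    fin_cases i <;> simp [Polygon.edgePath, AffineMap.lineMap_apply, E, frame] <;> ring
  refine ⟨?_, ?_, 3, ⟨![p, p + u, p + v]⟩, le_rfl, ?_, ?_⟩
  · refine IsCompact.image ?_ (frameHomeo p u v h).continuous
    have hc : IsCompact (Icc (0 : ℝ) 1 ×ˢ Icc (0 : ℝ) 1) := isCompact_Icc.prod isCompact_Icc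
    refine hc.of_isClosed_subset isClosed_simplex ?_
    rintro ⟨x, y⟩ ⟨h1, h2, h3⟩
    simp only at h1 h2 h3
    exact ⟨⟨h1, by simp only; linarith⟩, h2, by simp only; linarith⟩
  · rw [tri, interior_frame_image p h, interior_simplex]
    exact ⟨_, (1 / 3, 1 / 3), by norm_num, rfl⟩
  · rintro ⟨i, s, hs⟩ ⟨i', s', hs'⟩ hh
    simp only [hE] at hh
    have h3 := frame_injective p h hh
    obtain ⟨h1, h2⟩ := hs
    obtain ⟨h1', h2'⟩ := hs'
    fin_cases i <;> fin_cases i' <;> simp [E] at h3 <;>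
      first | (exfalso; linarith [h3.1, h3.2]) | (subst h3; rfl)
  · rw [tri, frontier_frame_image p h, isClosed_simplex.frontier_eq, interior_simplex]
    ext z
    simp only [Polygon.boundary, Polygon.edgeSet_eq_image_edgePath, mem_iUnion, mem_image, hE]
    constructor
    · rintro ⟨⟨x, y⟩, ⟨⟨hx0, hy0, hxy⟩, hq⟩, rfl⟩
      simp only at hx0 hy0 hxy
      simp only [mem_ofPred_eq, not_and_or, not_lt] at hq
      rcases hq with hq | hq | hq
      · exact ⟨2, 1 - y, ⟨by linarith, by linarith⟩, by simp [E]; congr; linarith⟩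
      · exact ⟨0, x, ⟨by linarith, by linarith⟩, by simp [E]; congr; linarith⟩
      · exact ⟨1, y, ⟨by linarith, by linarith⟩, by simp [E]; congr; linarith⟩
    · rintro ⟨i, s, ⟨hs0, hs1⟩, rfl⟩
      refine ⟨E i s, ?_, rfl⟩
      fin_cases i <;> simp [E, hs0, hs1]

/-! ### Dissections whose pieces are turned in place -/

/-- `P` is tiled by `k` polygons, each of which is mapped onto itself by a rigid motion in such a
way that the boundary of `P` is covered by the moved internal cuts. -/
def HasInPlaceDissection (k : ℕ) (P : Set ℂ) : Prop :=
  ∃ (Q : Fin k → Set ℂ) (a : Fin k → Circle) (b : Fin k → ℂ),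
    (∀ i, IsPolygonalRegion (Q i)) ∧ IsTiledBy P Q ∧
    (∀ i, rigidMotion (a i) (b i) '' Q i = Q i) ∧
    frontier P ⊆ ⋃ i, rigidMotion (a i) (b i) '' internalCuts P (Q i)

theorem HasInPlaceDissection.exists_isInsideOutDissection {k : ℕ} {P : Set ℂ}
    (h : HasInPlaceDissection k P) : ∃ Q : Fin k → Set ℂ, IsInsideOutDissection P Q := by
  obtain ⟨Q, a, b, h1, h2, h3, h4⟩ := h
  refine ⟨Q, h1, h2, a, b, P, ⟨IsometryEquiv.refl ℂ, (image_id P).symm⟩, ?_, h4⟩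
  have e : (fun i => rigidMotion (a i) (b i) '' Q i) = Q := funext h3
  rw [e]
  exact h2

theorem rigidMotion_apply (a : Circle) (b z : ℂ) : rigidMotion a b z = a * z + b := by
  simp [rigidMotion, rotation_apply]

/-- The similarity `z ↦ c + w z`. -/
noncomputable def similarity (c w : ℂ) (hw : w ≠ 0) : ℂ ≃ₜ ℂ :=
  (Homeomorph.mulLeft₀ w hw).trans (Homeomorph.addLeft c)

theorem similarity_apply (c w : ℂ) (hw : w ≠ 0) (z : ℂ) : similarity c w hw z = c + w * z := rfl

theorem isPolygonalRegion_similarity_image {A : Set ℂ} (hA : IsPolygonalRegion A) (c w : ℂ)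
    (hw : w ≠ 0) : IsPolygonalRegion (similarity c w hw '' A) := by
  obtain ⟨h1, h2, n, γ, hn, hs, hb⟩ := hA
  set f := similarity c w hw
  have hpath : ∀ i s, Polygon.edgePath ℝ (⟨fun i => f (γ i)⟩ : Polygon ℂ n) i s
      = f (γ.edgePath ℝ i s) := by
    intro i s
    simp only [Polygon.edgePath, AffineMap.lineMap_apply, f, similarity_apply, vsub_eq_sub,
      vadd_eq_add, Complex.real_smul]
    ring
  refine ⟨h1.image f.continuous, ?_, n, ⟨fun i => f (γ i)⟩, hn, ?_, ?_⟩
  · rw [← f.image_interior]; exact h2.image _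
  · intro x y hxy
    simp only [hpath] at hxy
    exact hs (f.injective hxy)
  · rw [← f.image_frontier, hb]
    simp only [Polygon.boundary, Polygon.edgeSet_eq_image_edgePath, image_iUnion, image_image,
      hpath]

theorem HasInPlaceDissection.similarity_image {k : ℕ} {P : Set ℂ} (h : HasInPlaceDissection k P)
    (c w : ℂ) (hw : w ≠ 0) : HasInPlaceDissection k (similarity c w hw '' P) := by
  obtain ⟨Q, a, b, h1, h2, h3, h4⟩ := h
  set f := similarity c w hw
  have hcomm : ∀ i z, rigidMotion (a i) (c + w * b i - a i * c) (f z) =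
      f (rigidMotion (a i) (b i) z) := by
    intro i z
    simp only [rigidMotion_apply, f, similarity_apply]; ring
  have himg : ∀ i (A : Set ℂ), rigidMotion (a i) (c + w * b i - a i * c) '' (f '' A)
      = f '' (rigidMotion (a i) (b i) '' A) := by
    intro i A
    simp only [image_image, hcomm]
  refine ⟨fun i => f '' Q i, a, fun i => c + w * b i - a i * c,
    fun i => isPolygonalRegion_similarity_image (h1 i) c w hw, ⟨?_, ?_⟩, ?_, ?_⟩
  · rw [← image_iUnion, h2.iUnion_eq]
  · intro i j hij
    simp only [← f.image_interior]
    exact (disjoint_image_iff f.injective).2 (h2.disjoint_interior hij)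
  · intro i
    rw [himg, h3]
  · have hcut : ∀ i, internalCuts (f '' P) (f '' Q i) = f '' internalCuts P (Q i) := by
      intro i
      simp only [internalCuts, ← f.image_frontier, ← f.image_interior, ← image_inter f.injective,
        f.image_closure]
    simp only [hcut, himg, ← f.image_frontier, ← image_iUnion]
    exact image_mono h4

/-! ### Dissections in affine coordinates -/

/-- An in-place dissection may be checked in affine coordinates. -/
theorem hasInPlaceDissection_frame {p u v : ℂ} (h : Indep u v) {k : ℕ} {S : Set (ℝ × ℝ)}
    (T : Fin k → Set (ℝ × ℝ)) (g : Fin k → ℝ × ℝ → ℝ × ℝ) (a : Fin k → Circle) (b : Fin k → ℂ)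
    (hg : ∀ i q, frame p u v (g i q) = a i * frame p u v q + b i)
    (hpoly : ∀ i, IsPolygonalRegion (frame p u v '' T i)) (hunion : ⋃ i, T i = S)
    (hdisj : Pairwise fun i j => Disjoint (interior (T i)) (interior (T j)))
    (hinv : ∀ i, g i '' T i = T i)
    (hcut : frontier S ⊆ ⋃ i, g i '' closure (frontier (T i) ∩ interior S)) :
    HasInPlaceDissection k (frame p u v '' S) := by
  have himg : ∀ i (A : Set (ℝ × ℝ)), rigidMotion (a i) (b i) '' (frame p u v '' A)
      = frame p u v '' (g i '' A) := by
    intro i A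
    simp only [image_image, hg, rigidMotion_apply]
  refine ⟨fun i => frame p u v '' T i, a, b, hpoly, ⟨?_, ?_⟩, ?_, ?_⟩
  · rw [← image_iUnion, hunion]
  · intro i j hij
    simp only [interior_frame_image p h]
    exact (disjoint_image_iff (frame_injective p h)).2 (hdisj hij)
  · intro i
    rw [himg, hinv]
  · have : ∀ i, internalCuts (frame p u v '' S) (frame p u v '' T i)
        = frame p u v '' closure (frontier (T i) ∩ interior S) := by
      intro i
      rw [internalCuts, frontier_frame_image p h, interior_frame_image p h,
        ← image_inter (frame_injective p h), ← frameHomeo_coe p u v h, Homeomorph.image_closure]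
    simp only [this, himg, frontier_frame_image p h, ← image_iUnion]
    exact image_mono hcut

/-- The rotation by `π`. -/
theorem exists_circle_eq_neg_one : ∃ a : Circle, (a : ℂ) = -1 :=
  ⟨Circle.exp Real.pi, by simp [Circle.coe_exp]⟩

/-- If the open segment from `A` to `A + D` lies in `X`, then the closed segment lies in the closure
of `X`. -/
theorem mem_closure_of_segment {X : Set (ℝ × ℝ)} (A D : ℝ × ℝ)
    (h : ∀ s : ℝ, 0 < s → s < 1 → (A.1 + s * D.1, A.2 + s * D.2) ∈ X) (s : ℝ) (hs0 : 0 ≤ s)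
    (hs1 : s ≤ 1) : (A.1 + s * D.1, A.2 + s * D.2) ∈ closure X := by
  have hs : s ∈ closure (Ioo (0 : ℝ) 1) := by rw [closure_Ioo (by norm_num)]; exact ⟨hs0, hs1⟩
  exact map_mem_closure (f := fun s : ℝ => (A.1 + s * D.1, A.2 + s * D.2)) (by fun_prop) hs
    fun s hs => h s hs.1 hs.2

theorem image_eq_of_leftInverse {α : Type*} {T : Set α} {g g' : α → α} (h : ∀ q ∈ T, g q ∈ T)
    (h' : ∀ q ∈ T, g' q ∈ T) (hgg : ∀ q, g (g' q) = q) : g '' T = T := by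
  ext q
  exact ⟨fun ⟨r, hr, e⟩ => e ▸ h r hr, fun hq => ⟨g' q, h' q hq, hgg q⟩⟩

/-- The parallelogram with centre `C` whose sides lie on the lines where one of the linear forms
with coefficients `L` and `M` differs by `1 / 2` from its value at `C`. -/
def box (L M C : ℝ × ℝ) : Set (ℝ × ℝ) :=
  {q | -1 / 2 ≤ L.1 * (q.1 - C.1) + L.2 * (q.2 - C.2) ∧
    L.1 * (q.1 - C.1) + L.2 * (q.2 - C.2) ≤ 1 / 2 ∧
    -1 / 2 ≤ M.1 * (q.1 - C.1) + M.2 * (q.2 - C.2) ∧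
    M.1 * (q.1 - C.1) + M.2 * (q.2 - C.2) ≤ 1 / 2}

/-- The point reflection in `C`. -/
def flip (C q : ℝ × ℝ) : ℝ × ℝ := (2 * C.1 - q.1, 2 * C.2 - q.2)

theorem interior_box {L M : ℝ × ℝ} (h : L.1 * M.2 - L.2 * M.1 ≠ 0) (C : ℝ × ℝ) :
    interior (box L M C) = {q | -1 / 2 < L.1 * (q.1 - C.1) + L.2 * (q.2 - C.2) ∧
      L.1 * (q.1 - C.1) + L.2 * (q.2 - C.2) < 1 / 2 ∧
      -1 / 2 < M.1 * (q.1 - C.1) + M.2 * (q.2 - C.2) ∧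
      M.1 * (q.1 - C.1) + M.2 * (q.2 - C.2) < 1 / 2} := by
  have hL : L.1 ^ 2 + L.2 ^ 2 ≠ 0 := fun h0 => h (by
    rw [show L.1 = 0 by nlinarith [sq_nonneg L.1, sq_nonneg L.2],
      show L.2 = 0 by nlinarith [sq_nonneg L.1, sq_nonneg L.2]]; ring)
  have hM : M.1 ^ 2 + M.2 ^ 2 ≠ 0 := fun h0 => h (by
    rw [show M.1 = 0 by nlinarith [sq_nonneg M.1, sq_nonneg M.2],
      show M.2 = 0 by nlinarith [sq_nonneg M.1, sq_nonneg M.2]]; ring)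
  have e : box L M C = halfPlane (-L.1) (-L.2) (1 / 2 - L.1 * C.1 - L.2 * C.2) ∩
      (halfPlane L.1 L.2 (1 / 2 + L.1 * C.1 + L.2 * C.2) ∩
      (halfPlane (-M.1) (-M.2) (1 / 2 - M.1 * C.1 - M.2 * C.2) ∩
      halfPlane M.1 M.2 (1 / 2 + M.1 * C.1 + M.2 * C.2))) := by
    ext q
    simp only [box, halfPlane, mem_inter_iff, mem_ofPred_eq]
    refine and_congr ?_ (and_congr ?_ (and_congr ?_ ?_)) <;> constructor <;> intro _ <;> linarith
  rw [e, interior_inter, interior_inter, interior_inter, interior_halfPlane (by simpa using hL),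
    interior_halfPlane hL, interior_halfPlane (by simpa using hM), interior_halfPlane hM]
  ext q
  simp only [mem_inter_iff, mem_ofPred_eq]
  refine and_congr ?_ (and_congr ?_ (and_congr ?_ ?_)) <;> constructor <;> intro _ <;> linarith

theorem isPolygonalRegion_frame_box (p : ℂ) {u v : ℂ} (huv : Indep u v) {L M : ℝ × ℝ}
    (h : L.1 * M.2 - L.2 * M.1 ≠ 0) (C : ℝ × ℝ) :
    IsPolygonalRegion (frame p u v '' box L M C) := by
  set d := L.1 * M.2 - L.2 * M.1 with hd
  -- `U` and `V` form the basis dual to the linear forms `L` and `M`.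
  let U : ℝ × ℝ := (M.2 / d, -M.1 / d)
  let V : ℝ × ℝ := (-L.2 / d, L.1 / d)
  have e : frame p u v '' box L M C =
      para (frame p u v (C.1 - U.1 / 2 - V.1 / 2, C.2 - U.2 / 2 - V.2 / 2))
      (U.1 * u + U.2 * v) (V.1 * u + V.2 * v) := by
    have e1 : box L M C = (fun q : ℝ × ℝ => (C.1 + (q.1 - 1 / 2) * U.1 + (q.2 - 1 / 2) * V.1,
        C.2 + (q.1 - 1 / 2) * U.2 + (q.2 - 1 / 2) * V.2)) '' (Icc 0 1 ×ˢ Icc 0 1) := by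
      ext q
      simp only [box, mem_prod, mem_Icc, mem_image, mem_ofPred_eq]
      constructor
      · rintro ⟨h1, h2, h3, h4⟩
        refine ⟨(L.1 * (q.1 - C.1) + L.2 * (q.2 - C.2) + 1 / 2,
          M.1 * (q.1 - C.1) + M.2 * (q.2 - C.2) + 1 / 2),
          ⟨⟨by simp only; linarith, by simp only; linarith⟩, by simp only; linarith,
            by simp only; linarith⟩, ?_⟩
        ext <;> simp only [U, V] <;> field_simp <;> rw [hd] <;> ring
      · rintro ⟨q, ⟨⟨h1, h2⟩, h3, h4⟩, rfl⟩
        have e2 : L.1 * (C.1 + (q.1 - 1 / 2) * U.1 + (q.2 - 1 / 2) * V.1 - C.1) +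
            L.2 * (C.2 + (q.1 - 1 / 2) * U.2 + (q.2 - 1 / 2) * V.2 - C.2) = q.1 - 1 / 2 := by
          simp only [U, V]; field_simp; rw [hd]; ring
        have e3 : M.1 * (C.1 + (q.1 - 1 / 2) * U.1 + (q.2 - 1 / 2) * V.1 - C.1) +
            M.2 * (C.2 + (q.1 - 1 / 2) * U.2 + (q.2 - 1 / 2) * V.2 - C.2) = q.2 - 1 / 2 := by
          simp only [U, V]; field_simp; rw [hd]; ring
        simp only [e2, e3]
        exact ⟨by linarith, by linarith, by linarith, by linarith⟩
    rw [e1, image_image, para]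
    congr 1
    funext q
    simp only [frame]; push_cast; ring
  rw [e]
  apply isPolygonalRegion_para
  unfold Indep at huv ⊢
  have : U.1 * V.2 - U.2 * V.1 ≠ 0 := by
    have : U.1 * V.2 - U.2 * V.1 = 1 / d := by
      simp only [U, V]; field_simp; rw [hd]; ring
    rw [this]; exact one_div_ne_zero h
  convert mul_ne_zero this huv using 1
  simp only [Complex.add_re, Complex.mul_re, Complex.add_im, Complex.mul_im, Complex.ofReal_re,
    Complex.ofReal_im]
  ring

theorem flip_image_box (L M C : ℝ × ℝ) : flip C '' box L M C = box L M C := by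
  have : ∀ q ∈ box L M C, flip C q ∈ box L M C := by
    rintro q ⟨h1, h2, h3, h4⟩
    simp only [box, flip, mem_ofPred_eq]
    exact ⟨by linarith, by linarith, by linarith, by linarith⟩
  exact image_eq_of_leftInverse this this fun q => by ext <;> simp [flip]

theorem frame_flip (p u v : ℂ) (C q : ℝ × ℝ) :
    frame p u v (flip C q) = -1 * frame p u v q + 2 * frame p u v C := by
  simp only [frame, flip]; push_cast; ring

/-- A point `q` belongs to a moved internal cut if it is the image of a point of a segment whose
open part runs along the boundary of the piece `T` and inside `S`. -/
theorem mem_image_cut {S T : Set (ℝ × ℝ)} {g : ℝ × ℝ → ℝ × ℝ} (A D : ℝ × ℝ) (s : ℝ) {q : ℝ × ℝ}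
    (hs0 : 0 ≤ s) (hs1 : s ≤ 1) (hq : g (A.1 + s * D.1, A.2 + s * D.2) = q)
    (h : ∀ s : ℝ, 0 < s → s < 1 → (A.1 + s * D.1, A.2 + s * D.2) ∈ T ∧
      (A.1 + s * D.1, A.2 + s * D.2) ∉ interior T ∧ (A.1 + s * D.1, A.2 + s * D.2) ∈ interior S) :
    q ∈ g '' closure (frontier T ∩ interior S) :=
  ⟨_, mem_closure_of_segment A D (fun s h0 h1 => by
    obtain ⟨h2, h3, h4⟩ := h s h0 h1
    exact ⟨(mem_sdiff _).2 ⟨subset_closure h2, h3⟩, h4⟩) s hs0 hs1, hq⟩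

/-- A tiling by parallelograms is an in-place dissection if the reflections of the internal cuts
in the centres of the parallelograms cover the boundary. -/
theorem hasInPlaceDissection_boxes (p : ℂ) {u v : ℂ} (h : Indep u v) {k : ℕ} {S : Set (ℝ × ℝ)}
    (L M C : Fin k → ℝ × ℝ) (hLM : ∀ i, (L i).1 * (M i).2 - (L i).2 * (M i).1 ≠ 0)
    (hunion : ⋃ i, box (L i) (M i) (C i) = S)
    (hdisj : Pairwise fun i j =>
      Disjoint (interior (box (L i) (M i) (C i))) (interior (box (L j) (M j) (C j))))
    (hcut : frontier S ⊆
      ⋃ i, flip (C i) '' closure (frontier (box (L i) (M i) (C i)) ∩ interior S)) :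
    HasInPlaceDissection k (frame p u v '' S) := by
  obtain ⟨a, ha⟩ := exists_circle_eq_neg_one
  refine hasInPlaceDissection_frame h _ (fun i => flip (C i)) (fun _ => a)
    (fun i => 2 * frame p u v (C i)) ?_ (fun i => isPolygonalRegion_frame_box p h (hLM i) (C i))
    hunion hdisj (fun i => flip_image_box _ _ _) hcut
  intro i q
  rw [frame_flip, ha]

/-! ### The square -/

/-- The square, in coordinates in which its sides have length `2`. -/
def squareModel : Set (ℝ × ℝ) := {q | 0 ≤ q.1 ∧ q.1 ≤ 2 ∧ 0 ≤ q.2 ∧ q.2 ≤ 2}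

theorem interior_squareModel :
    interior squareModel = {q | 0 < q.1 ∧ q.1 < 2 ∧ 0 < q.2 ∧ q.2 < 2} := by
  have e : squareModel = halfPlane (-1) 0 0 ∩ (halfPlane 1 0 2 ∩
      (halfPlane 0 (-1) 0 ∩ halfPlane 0 1 2)) := by
    ext q; simp [squareModel, halfPlane]
  rw [e]
  simp only [interior_inter]
  repeat rw [interior_halfPlane (by norm_num)]
  ext q; simp

theorem isClosed_squareModel : IsClosed squareModel := by
  have e : squareModel = Icc 0 2 ×ˢ Icc 0 2 := by
    ext ⟨x, y⟩; simp [squareModel, and_assoc, -Icc_prod_Icc]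
  rw [e]; exact isClosed_Icc.prod isClosed_Icc

/-- The square is cut along the segments that join the midpoints of opposite sides. -/
theorem hasInPlaceDissection_square (p : ℂ) {u v : ℂ} (h : Indep u v) :
    HasInPlaceDissection 4 (frame p u v '' squareModel) := by
  refine hasInPlaceDissection_boxes p h (fun _ => (1, 0)) (fun _ => (0, 1))
    ![(1 / 2, 1 / 2), (3 / 2, 1 / 2), (1 / 2, 3 / 2), (3 / 2, 3 / 2)] (by norm_num) ?_ ?_ ?_
  · ext ⟨x, y⟩
    simp only [mem_iUnion, box, squareModel, mem_ofPred_eq]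
    constructor
    · rintro ⟨i, h⟩
      fin_cases i <;> simp at h <;> refine ⟨?_, ?_, ?_, ?_⟩ <;> linarith
    · rintro ⟨h1, h2, h3, h4⟩
      rcases le_total x 1 with hx | hx <;> rcases le_total y 1 with hy | hy
      · refine ⟨0, ?_, ?_, ?_, ?_⟩ <;> simp <;> linarith
      · refine ⟨2, ?_, ?_, ?_, ?_⟩ <;> simp <;> linarith
      · refine ⟨1, ?_, ?_, ?_, ?_⟩ <;> simp <;> linarith
      · refine ⟨3, ?_, ?_, ?_, ?_⟩ <;> simp <;> linarith
  · intro i j hij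
    rw [disjoint_left]
    rintro ⟨x, y⟩ h1 h2
    rw [interior_box (by norm_num)] at h1 h2
    simp only [mem_ofPred_eq] at h1 h2
    fin_cases i <;> fin_cases j <;> simp at hij h1 h2 <;> linarith
  · rintro ⟨x, y⟩ hq
    rw [isClosed_squareModel.frontier_eq, interior_squareModel] at hq
    obtain ⟨⟨h1, h2, h3, h4⟩, hq⟩ := hq
    simp only [mem_ofPred_eq, not_and_or, not_lt] at h1 h2 h3 h4 hq
    -- `A` is an endpoint and `D` the direction of the internal cut in the `i`-th piece whose
    -- reflection contains the given boundary point.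
    have key : ∃ (i : Fin 4) (A D : ℝ × ℝ) (s : ℝ), 0 ≤ s ∧ s ≤ 1 ∧
        flip (![(1 / 2, 1 / 2), (3 / 2, 1 / 2), (1 / 2, 3 / 2), (3 / 2, 3 / 2)] i)
          (A.1 + s * D.1, A.2 + s * D.2) = (x, y) ∧
        ((i, A, D) ∈ ({(0, (1, 0), (0, 1)), (0, (0, 1), (1, 0)), (1, (1, 0), (0, 1)),
          (1, (1, 1), (1, 0)), (2, (0, 1), (1, 0)), (2, (1, 1), (0, 1)), (3, (1, 1), (1, 0)),
          (3, (1, 1), (0, 1))} : Set (Fin 4 × (ℝ × ℝ) × (ℝ × ℝ)))) := by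
      rcases hq with hq | hq | hq | hq
      · rcases le_total y 1 with hy | hy
        · exact ⟨0, (1, 0), (0, 1), 1 - y, by linarith, by linarith,
            by ext <;> simp [flip]; linarith, by simp⟩
        · exact ⟨2, (1, 1), (0, 1), 2 - y, by linarith, by linarith,
            by ext <;> simp [flip] <;> linarith, by simp⟩
      · rcases le_total y 1 with hy | hy
        · exact ⟨1, (1, 0), (0, 1), 1 - y, by linarith, by linarith,
            by ext <;> simp [flip]; linarith, by simp⟩
        · exact ⟨3, (1, 1), (0, 1), 2 - y, by linarith, by linarith,
            by ext <;> simp [flip] <;> linarith, by simp⟩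
      · rcases le_total x 1 with hy | hy
        · exact ⟨0, (0, 1), (1, 0), 1 - x, by linarith, by linarith,
            by ext <;> simp [flip]; linarith, by simp⟩
        · exact ⟨1, (1, 1), (1, 0), 2 - x, by linarith, by linarith,
            by ext <;> simp [flip] <;> linarith, by simp⟩
      · rcases le_total x 1 with hy | hy
        · exact ⟨2, (0, 1), (1, 0), 1 - x, by linarith, by linarith,
            by ext <;> simp [flip]; linarith, by simp⟩
        · exact ⟨3, (1, 1), (1, 0), 2 - x, by linarith, by linarith,
            by ext <;> simp [flip] <;> linarith, by simp⟩
    obtain ⟨i, A, D, s, hs0, hs1, he, hm⟩ := key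
    refine mem_iUnion.2 ⟨i, mem_image_cut A D s hs0 hs1 he fun s hs0 hs1 => ?_⟩
    rw [interior_box (by norm_num), interior_squareModel]
    simp only [mem_insert_iff, mem_singleton_iff, Prod.mk.injEq] at hm
    rcases hm with ⟨rfl, rfl, rfl⟩ | ⟨rfl, rfl, rfl⟩ | ⟨rfl, rfl, rfl⟩ | ⟨rfl, rfl, rfl⟩ |
      ⟨rfl, rfl, rfl⟩ | ⟨rfl, rfl, rfl⟩ | ⟨rfl, rfl, rfl⟩ | ⟨rfl, rfl, rfl⟩ <;>
      (refine ⟨?_, ?_, ?_⟩ <;> simp [box] <;> (try norm_num) <;> (try constructorm* _ ∧ _) <;>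
        linarith)

/-! ### The regular hexagon -/

/-- The regular hexagon, in coordinates with respect to two of its vertices that are not adjacent,
its centre being the origin. -/
def hexagonModel : Set (ℝ × ℝ) :=
  {q | -1 ≤ q.1 ∧ q.1 ≤ 1 ∧ -1 ≤ q.2 ∧ q.2 ≤ 1 ∧ q.1 - q.2 ≤ 1 ∧ q.2 - q.1 ≤ 1}

theorem hexagonModel_eq : hexagonModel = halfPlane (-1) 0 1 ∩ (halfPlane 1 0 1 ∩
    (halfPlane 0 (-1) 1 ∩ (halfPlane 0 1 1 ∩ (halfPlane 1 (-1) 1 ∩ halfPlane (-1) 1 1)))) := by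
  ext q
  simp only [hexagonModel, halfPlane, mem_inter_iff, mem_ofPred_eq]
  refine and_congr ?_ (and_congr ?_ (and_congr ?_ (and_congr ?_ (and_congr ?_ ?_)))) <;>
    constructor <;> intro _ <;> linarith

theorem interior_hexagonModel : interior hexagonModel =
    {q | -1 < q.1 ∧ q.1 < 1 ∧ -1 < q.2 ∧ q.2 < 1 ∧ q.1 - q.2 < 1 ∧ q.2 - q.1 < 1} := by
  rw [hexagonModel_eq]
  simp only [interior_inter]
  repeat rw [interior_halfPlane (by norm_num)]
  ext q
  simp only [mem_inter_iff, mem_ofPred_eq]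
  refine and_congr ?_ (and_congr ?_ (and_congr ?_ (and_congr ?_ (and_congr ?_ ?_)))) <;>
    constructor <;> intro _ <;> linarith

theorem isClosed_hexagonModel : IsClosed hexagonModel := by
  rw [hexagonModel_eq]
  repeat first | exact isClosed_halfPlane _ _ _ | refine (isClosed_halfPlane _ _ _).inter ?_

/-- The hexagon is cut along three of its radii, from the centre to every other vertex. -/
theorem hasInPlaceDissection_hexagon (p : ℂ) {u v : ℂ} (h : Indep u v) :
    HasInPlaceDissection 3 (frame p u v '' hexagonModel) := by
  have hLM : ∀ i : Fin 3, ((![(1, 0), (1, 0), (0, 1)] : Fin 3 → ℝ × ℝ) i).1 *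
      ((![(0, 1), (-1, 1), (1, -1)] : Fin 3 → ℝ × ℝ) i).2 -
      ((![(1, 0), (1, 0), (0, 1)] : Fin 3 → ℝ × ℝ) i).2 *
      ((![(0, 1), (-1, 1), (1, -1)] : Fin 3 → ℝ × ℝ) i).1 ≠ 0 := by
    intro i; fin_cases i <;> simp
  refine hasInPlaceDissection_boxes p h ![(1, 0), (1, 0), (0, 1)] ![(0, 1), (-1, 1), (1, -1)]
    ![(1 / 2, 1 / 2), (-1 / 2, 0), (0, -1 / 2)] hLM ?_ ?_ ?_
  · ext ⟨x, y⟩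
    simp only [mem_iUnion, box, hexagonModel, mem_ofPred_eq]
    constructor
    · rintro ⟨i, h⟩
      fin_cases i <;> simp at h <;> refine ⟨?_, ?_, ?_, ?_, ?_, ?_⟩ <;> linarith
    · rintro ⟨h1, h2, h3, h4, h5, h6⟩
      by_cases hp : 0 ≤ x ∧ 0 ≤ y
      · refine ⟨0, ?_, ?_, ?_, ?_⟩ <;> simp <;> linarith
      · by_cases hxy : x ≤ y
        · have : x ≤ 0 := by by_contra hx; exact hp ⟨by linarith, by linarith⟩
          refine ⟨1, ?_, ?_, ?_, ?_⟩ <;> simp <;> linarith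
        · have : y ≤ 0 := by by_contra hx; exact hp ⟨by linarith, by linarith⟩
          refine ⟨2, ?_, ?_, ?_, ?_⟩ <;> simp <;> linarith
  · intro i j hij
    rw [disjoint_left]
    rintro ⟨x, y⟩ h1 h2
    rw [interior_box (hLM _)] at h1 h2
    simp only [mem_ofPred_eq] at h1 h2
    fin_cases i <;> fin_cases j <;> simp at hij h1 h2 <;> linarith
  · rintro ⟨x, y⟩ hq
    rw [isClosed_hexagonModel.frontier_eq, interior_hexagonModel] at hq
    obtain ⟨⟨h1, h2, h3, h4, h5, h6⟩, hq⟩ := hq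
    simp only [mem_ofPred_eq, not_and_or, not_lt] at h1 h2 h3 h4 h5 h6 hq
    -- `D` is the endpoint other than the centre of the internal cut along the `i`-th piece whose
    -- reflection contains the given boundary point.
    have key : ∃ (i : Fin 3) (D : ℝ × ℝ) (s : ℝ), 0 ≤ s ∧ s ≤ 1 ∧
        flip (![(1 / 2, 1 / 2), (-1 / 2, 0), (0, -1 / 2)] i)
          ((0, 0).1 + s * D.1, (0, 0).2 + s * D.2) = (x, y) ∧
        ((i, D) ∈ ({(0, (1, 0)), (0, (0, 1)), (1, (0, 1)), (1, (-1, -1)), (2, (-1, -1)),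
          (2, (1, 0))} : Set (Fin 3 × (ℝ × ℝ)))) := by
      rcases hq with hq | hq | hq | hq | hq | hq
      · exact ⟨1, (0, 1), -y, by linarith, by linarith, by ext <;> simp [flip]; linarith, by simp⟩
      · exact ⟨0, (0, 1), 1 - y, by linarith, by linarith,
          by ext <;> simp [flip]; linarith, by simp⟩
      · exact ⟨2, (1, 0), -x, by linarith, by linarith, by ext <;> simp [flip]; linarith, by simp⟩
      · exact ⟨0, (1, 0), 1 - x, by linarith, by linarith,
          by ext <;> simp [flip]; linarith, by simp⟩
      · exact ⟨2, (-1, -1), 1 + y, by linarith, by linarith,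
          by ext <;> simp [flip] <;> linarith, by simp⟩
      · exact ⟨1, (-1, -1), 1 + x, by linarith, by linarith,
          by ext <;> simp [flip] <;> linarith, by simp⟩
    obtain ⟨i, D, s, hs0, hs1, he, hm⟩ := key
    refine mem_iUnion.2 ⟨i, mem_image_cut (0, 0) D s hs0 hs1 he fun s hs0 hs1 => ?_⟩
    rw [interior_box (hLM _), interior_hexagonModel]
    simp only [mem_insert_iff, mem_singleton_iff, Prod.mk.injEq] at hm
    rcases hm with ⟨rfl, rfl⟩ | ⟨rfl, rfl⟩ | ⟨rfl, rfl⟩ | ⟨rfl, rfl⟩ | ⟨rfl, rfl⟩ | ⟨rfl, rfl⟩ <;>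
      (refine ⟨?_, ?_, ?_⟩ <;> simp [box] <;> (try norm_num) <;>
        (try constructorm* _ ∧ _) <;> linarith)

/-! ### The equilateral triangle -/

/-- The triangle with vertices `C`, `C + (1, 0)` and `C + (0, 1)`. -/
def smallTriangle (C : ℝ × ℝ) : Set (ℝ × ℝ) :=
  {q | C.1 ≤ q.1 ∧ C.2 ≤ q.2 ∧ q.1 + q.2 ≤ C.1 + C.2 + 1}

/-- The affine map that permutes the vertices of `smallTriangle C` cyclically. -/
def turn (C q : ℝ × ℝ) : ℝ × ℝ := (C.1 + 1 - (q.1 - C.1) - (q.2 - C.2), C.2 + (q.1 - C.1))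

theorem interior_smallTriangle (C : ℝ × ℝ) : interior (smallTriangle C) =
    {q | C.1 < q.1 ∧ C.2 < q.2 ∧ q.1 + q.2 < C.1 + C.2 + 1} := by
  have e : smallTriangle C = halfPlane (-1) 0 (-C.1) ∩
      (halfPlane 0 (-1) (-C.2) ∩ halfPlane 1 1 (C.1 + C.2 + 1)) := by
    ext q; simp [smallTriangle, halfPlane]
  rw [e, interior_inter, interior_inter]
  repeat rw [interior_halfPlane (by norm_num)]
  ext q; simp

theorem isPolygonalRegion_frame_smallTriangle (p : ℂ) {u v : ℂ} (h : Indep u v) (C : ℝ × ℝ) :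
    IsPolygonalRegion (frame p u v '' smallTriangle C) := by
  have e : frame p u v '' smallTriangle C = tri (frame p u v C) u v := by
    have e1 : smallTriangle C = (fun q : ℝ × ℝ => (C.1 + q.1, C.2 + q.2)) ''
        {q | 0 ≤ q.1 ∧ 0 ≤ q.2 ∧ q.1 + q.2 ≤ 1} := by
      ext q
      simp only [smallTriangle, mem_image, mem_ofPred_eq]
      constructor
      · rintro ⟨h1, h2, h3⟩
        exact ⟨(q.1 - C.1, q.2 - C.2), ⟨by simp only; linarith, by simp only; linarith,
          by simp only; linarith⟩, by simp⟩
      · rintro ⟨r, ⟨h1, h2, h3⟩, rfl⟩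
        exact ⟨by simp only; linarith, by simp only; linarith, by simp only; linarith⟩
    rw [e1, image_image, tri]
    congr 1
    funext q
    simp only [frame]; push_cast; ring
  rw [e]
  exact isPolygonalRegion_tri _ h

theorem turn_image_smallTriangle (C : ℝ × ℝ) : turn C '' smallTriangle C = smallTriangle C := by
  have h : ∀ q ∈ smallTriangle C, turn C q ∈ smallTriangle C := by
    rintro q ⟨h1, h2, h3⟩
    refine ⟨?_, ?_, ?_⟩ <;> simp only [turn] <;> linarith
  refine image_eq_of_leftInverse h (fun q hq => h _ (h _ hq)) fun q => ?_
  ext <;> simp only [turn] <;> ring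

/-- If multiplication by `ω` takes `u` to `v - u` and `v` to `-u`, then it is in coordinates the
linear part of `turn`. -/
theorem frame_turn (p : ℂ) {u v ω : ℂ} (hu : ω * u = v - u) (hv : ω * v = -u) (C q : ℝ × ℝ) :
    frame p u v (turn C q) =
      ω * frame p u v q + (frame p u v C + u - ω * frame p u v C) := by
  simp only [frame, turn]
  push_cast
  linear_combination (C.1 - q.1) * hu + (C.2 - q.2) * hv

/-- The equilateral triangle, in coordinates in which its sides have length `3`. -/
def triangleModel : Set (ℝ × ℝ) := {q | 0 ≤ q.1 ∧ 0 ≤ q.2 ∧ q.1 + q.2 ≤ 3}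

theorem triangleModel_eq :
    triangleModel = halfPlane (-1) 0 0 ∩ (halfPlane 0 (-1) 0 ∩ halfPlane 1 1 3) := by
  ext q; simp [triangleModel, halfPlane]

theorem interior_triangleModel :
    interior triangleModel = {q | 0 < q.1 ∧ 0 < q.2 ∧ q.1 + q.2 < 3} := by
  rw [triangleModel_eq, interior_inter, interior_inter]
  repeat rw [interior_halfPlane (by norm_num)]
  ext q; simp

theorem isClosed_triangleModel : IsClosed triangleModel := by
  rw [triangleModel_eq]
  exact (isClosed_halfPlane _ _ _).inter ((isClosed_halfPlane _ _ _).inter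
    (isClosed_halfPlane _ _ _))

/-- Three rhombi at the corners and three triangles at the middles of the sides tile the
equilateral triangle. The rhombi are turned by `π`, the triangles by `2 * π / 3`. -/
def triangleTile : Fin 6 → Set (ℝ × ℝ) :=
  ![box (1, 0) (0, 1) (1 / 2, 1 / 2), box (1, 1) (0, 1) (2, 1 / 2), box (1, 1) (1, 0) (1 / 2, 2),
    smallTriangle (1, 0), smallTriangle (0, 1), smallTriangle (1, 1)]

/-- The motions belonging to the pieces `triangleTile`, in coordinates. -/
noncomputable def triangleMotion : Fin 6 → ℝ × ℝ → ℝ × ℝ :=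
  ![flip (1 / 2, 1 / 2), flip (2, 1 / 2), flip (1 / 2, 2), turn (1, 0), turn (0, 1), turn (1, 1)]

theorem interior_triangleTile (i : Fin 6) : interior (triangleTile i) =
    (![{q | 0 < q.1 ∧ q.1 < 1 ∧ 0 < q.2 ∧ q.2 < 1},
      {q | 2 < q.1 + q.2 ∧ q.1 + q.2 < 3 ∧ 0 < q.2 ∧ q.2 < 1},
      {q | 2 < q.1 + q.2 ∧ q.1 + q.2 < 3 ∧ 0 < q.1 ∧ q.1 < 1},
      {q | 1 < q.1 ∧ 0 < q.2 ∧ q.1 + q.2 < 2},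
      {q | 0 < q.1 ∧ 1 < q.2 ∧ q.1 + q.2 < 2},
      {q | 1 < q.1 ∧ 1 < q.2 ∧ q.1 + q.2 < 3}] : Fin 6 → Set (ℝ × ℝ)) i := by
  fin_cases i
  · refine (interior_box (by norm_num) _).trans (Set.ext fun q => ?_)
    simp only [mem_ofPred_eq]
    constructor <;> rintro ⟨h1, h2, h3, h4⟩ <;> refine ⟨?_, ?_, ?_, ?_⟩ <;> norm_num at * <;>
        linarith
  · refine (interior_box (by norm_num) _).trans (Set.ext fun q => ?_)
    simp only [mem_ofPred_eq]
    constructor <;> rintro ⟨h1, h2, h3, h4⟩ <;> refine ⟨?_, ?_, ?_, ?_⟩ <;> norm_num at * <;>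
        linarith
  · refine (interior_box (by norm_num) _).trans (Set.ext fun q => ?_)
    simp only [mem_ofPred_eq]
    constructor <;> rintro ⟨h1, h2, h3, h4⟩ <;> refine ⟨?_, ?_, ?_, ?_⟩ <;> norm_num at * <;>
        linarith
  · refine (interior_smallTriangle _).trans (Set.ext fun q => ?_)
    norm_num
  · refine (interior_smallTriangle _).trans (Set.ext fun q => ?_)
    norm_num
  · refine (interior_smallTriangle _).trans (Set.ext fun q => ?_)
    norm_num

theorem iUnion_triangleTile : ⋃ i, triangleTile i = triangleModel := by
  ext ⟨x, y⟩
  simp only [mem_iUnion, triangleModel, mem_ofPred_eq]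
  constructor
  · rintro ⟨i, h⟩
    fin_cases i <;> simp [triangleTile, box, smallTriangle] at h <;> refine ⟨?_, ?_, ?_⟩ <;>
        linarith
  · rintro ⟨h1, h2, h3⟩
    rcases le_total x 1 with hx | hx <;> rcases le_total y 1 with hy | hy <;>
      rcases le_total (x + y) 2 with hxy | hxy
    · refine ⟨0, ?_, ?_, ?_, ?_⟩ <;> simp <;> linarith
    · refine ⟨0, ?_, ?_, ?_, ?_⟩ <;> simp <;> linarith
    · refine ⟨4, ?_, ?_, ?_⟩ <;> simp <;> linarith
    · refine ⟨2, ?_, ?_, ?_, ?_⟩ <;> simp <;> linarith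
    · refine ⟨3, ?_, ?_, ?_⟩ <;> simp <;> linarith
    · refine ⟨1, ?_, ?_, ?_, ?_⟩ <;> simp <;> linarith
    · refine ⟨5, ?_, ?_, ?_⟩ <;> simp <;> linarith
    · refine ⟨5, ?_, ?_, ?_⟩ <;> simp <;> linarith

theorem frontier_triangleModel_subset : frontier triangleModel ⊆
    ⋃ i, triangleMotion i '' closure (frontier (triangleTile i) ∩ interior triangleModel) := by
  rintro ⟨x, y⟩ hq
  rw [isClosed_triangleModel.frontier_eq, interior_triangleModel] at hq
  obtain ⟨⟨h1, h2, h3⟩, hq⟩ := hq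
  simp only [mem_ofPred_eq, not_and_or, not_lt] at h1 h2 h3 hq
  -- `A` is an endpoint and `D` the direction of a segment of an internal cut along the `i`-th piece
  -- whose image contains the given boundary point.
  have key : ∃ (i : Fin 6) (A D : ℝ × ℝ) (s : ℝ), 0 ≤ s ∧ s ≤ 1 ∧
      triangleMotion i (A.1 + s * D.1, A.2 + s * D.2) = (x, y) ∧
      ((i, A, D) ∈ ({(0, (0, 1), (1, 0)), (3, (1, 0), (0, 1)), (1, (1, 1), (1, 0)),
        (0, (1, 0), (0, 1)), (4, (0, 2), (1, -1)), (2, (1, 1), (0, 1)),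
        (1, (2, 0), (-1, 1)), (5, (1, 1), (1, 0)), (2, (0, 2), (1, -1))} :
          Set (Fin 6 × (ℝ × ℝ) × (ℝ × ℝ)))) := by
    rcases hq with hq | hq | hq
    · rcases le_total y 1 with hy | hy
      · exact ⟨0, (1, 0), (0, 1), 1 - y, by linarith, by linarith,
          by ext <;> simp [triangleMotion, flip]; linarith, by simp⟩
      rcases le_total y 2 with hy | hy
      · exact ⟨4, (0, 2), (1, -1), y - 1, by linarith, by linarith,
          by ext <;> simp [triangleMotion, turn]; linarith, by simp⟩
      · exact ⟨2, (1, 1), (0, 1), 3 - y, by linarith, by linarith,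
          by ext <;> simp [triangleMotion, flip] <;> linarith, by simp⟩
    · rcases le_total x 1 with hy | hy
      · exact ⟨0, (0, 1), (1, 0), 1 - x, by linarith, by linarith,
          by ext <;> simp [triangleMotion, flip]; linarith, by simp⟩
      rcases le_total x 2 with hy | hy
      · exact ⟨3, (1, 0), (0, 1), 2 - x, by linarith, by linarith,
          by ext <;> simp [triangleMotion, turn] <;> linarith, by simp⟩
      · exact ⟨1, (1, 1), (1, 0), 3 - x, by linarith, by linarith,
          by ext <;> simp [triangleMotion, flip] <;> linarith, by simp⟩
    · rcases le_total x 1 with hy | hy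
      · exact ⟨2, (0, 2), (1, -1), 1 - x, by linarith, by linarith,
          by ext <;> simp [triangleMotion, flip]; linarith, by simp⟩
      rcases le_total x 2 with hy | hy
      · exact ⟨5, (1, 1), (1, 0), 2 - x, by linarith, by linarith,
          by ext <;> simp [triangleMotion, turn] <;> linarith, by simp⟩
      · exact ⟨1, (2, 0), (-1, 1), x - 2, by linarith, by linarith,
          by ext <;> simp [triangleMotion, flip] <;> linarith, by simp⟩
  obtain ⟨i, A, D, s, hs0, hs1, he, hm⟩ := key
  refine mem_iUnion.2 ⟨i, mem_image_cut A D s hs0 hs1 he fun s hs0 hs1 => ?_⟩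
  rw [interior_triangleTile, interior_triangleModel]
  simp only [mem_insert_iff, mem_singleton_iff, Prod.mk.injEq] at hm
  rcases hm with ⟨rfl, rfl, rfl⟩ | ⟨rfl, rfl, rfl⟩ | ⟨rfl, rfl, rfl⟩ | ⟨rfl, rfl, rfl⟩ |
    ⟨rfl, rfl, rfl⟩ | ⟨rfl, rfl, rfl⟩ | ⟨rfl, rfl, rfl⟩ | ⟨rfl, rfl, rfl⟩ | ⟨rfl, rfl, rfl⟩ <;>
    (refine ⟨?_, ?_, ?_⟩ <;> simp [triangleTile, box, smallTriangle] <;> (try norm_num) <;>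
      (try constructorm* _ ∧ _) <;> linarith)

/-- The hypotheses on `ω` say that the triangle spanned by `u` and `v` is equilateral. -/
theorem hasInPlaceDissection_triangle (p : ℂ) {u v : ℂ} (h : Indep u v) (ω : Circle)
    (hu : ω * u = v - u) (hv : ω * v = -u) :
    HasInPlaceDissection 6 (frame p u v '' triangleModel) := by
  obtain ⟨a, ha⟩ := exists_circle_eq_neg_one
  refine hasInPlaceDissection_frame h triangleTile triangleMotion ![a, a, a, ω, ω, ω]
    ![2 * frame p u v (1 / 2, 1 / 2), 2 * frame p u v (2, 1 / 2), 2 * frame p u v (1 / 2, 2),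
      frame p u v (1, 0) + u - ω * frame p u v (1, 0),
      frame p u v (0, 1) + u - ω * frame p u v (0, 1),
      frame p u v (1, 1) + u - ω * frame p u v (1, 1)] ?_ ?_ iUnion_triangleTile ?_ ?_
      frontier_triangleModel_subset
  · have h1 : ∀ C q, frame p u v (flip C q) = a * frame p u v q + 2 * frame p u v C :=
      fun C q => by rw [frame_flip, ha]
    intro i q
    fin_cases i
    · exact h1 _ _
    · exact h1 _ _
    · exact h1 _ _
    · exact frame_turn p hu hv _ _
    · exact frame_turn p hu hv _ _
    · exact frame_turn p hu hv _ _
  · intro i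
    fin_cases i
    · exact isPolygonalRegion_frame_box p h (by norm_num) _
    · exact isPolygonalRegion_frame_box p h (by norm_num) _
    · exact isPolygonalRegion_frame_box p h (by norm_num) _
    · exact isPolygonalRegion_frame_smallTriangle p h _
    · exact isPolygonalRegion_frame_smallTriangle p h _
    · exact isPolygonalRegion_frame_smallTriangle p h _
  · intro i j hij
    rw [disjoint_left]
    rintro ⟨x, y⟩ h1 h2
    rw [interior_triangleTile] at h1 h2
    fin_cases i <;> fin_cases j <;> simp at hij h1 h2 <;> linarith
  · intro i
    fin_cases i
    · exact flip_image_box _ _ _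
    · exact flip_image_box _ _ _
    · exact flip_image_box _ _ _
    · exact turn_image_smallTriangle _
    · exact turn_image_smallTriangle _
    · exact turn_image_smallTriangle _

/-! ### Regular polygons as convex hulls -/

/-- The regular `n`-gon with centre `0` and a vertex at `1`. -/
noncomputable def unitPolygon (n : ℕ) : Set ℂ :=
  convexHull ℝ (range fun j : Fin n =>
    Complex.exp (2 * Real.pi * Complex.I * ((j : ℕ) : ℂ) / (n : ℂ)))

theorem exists_similarity_of_isRegularPolygon {n : ℕ} {P : Set ℂ} (h : IsRegularPolygon n P) :
    ∃ (c w : ℂ) (hw : w ≠ 0), P = similarity c w hw '' unitPolygon n := by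
  obtain ⟨-, c, w, hw, rfl⟩ := h
  refine ⟨c, w, hw, ?_⟩
  let f : ℂ →ᵃ[ℝ] ℂ := (LinearMap.mulLeft ℝ w).toAffineMap + AffineMap.const ℝ ℂ c
  have hf : ⇑f = similarity c w hw := by
    funext z; simp [f, similarity_apply, add_comm]
  rw [unitPolygon, ← hf, f.image_convexHull, ← range_comp]
  congr 1
  congr 1
  funext j
  simp [hf, similarity_apply]

theorem exp_eq_pow (n j : ℕ) : Complex.exp (2 * Real.pi * Complex.I * (j : ℂ) / (n : ℂ)) =
    Complex.exp (2 * Real.pi * Complex.I / n) ^ j := by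
  rw [← Complex.exp_nat_mul]; congr 1; ring

theorem frame_image_convexHull (p u v : ℂ) (s : Set (ℝ × ℝ)) :
    frame p u v '' convexHull ℝ s = convexHull ℝ (frame p u v '' s) := by
  let f : ℝ × ℝ →ᵃ[ℝ] ℂ := ((LinearMap.fst ℝ ℝ ℝ).smulRight u +
    (LinearMap.snd ℝ ℝ ℝ).smulRight v).toAffineMap + AffineMap.const ℝ (ℝ × ℝ) p
  have hf : ⇑f = frame p u v := by
    funext q; simp [f, frame]; ring
  rw [← hf, f.image_convexHull]

theorem convex_halfPlane (α β c : ℝ) : Convex ℝ (halfPlane α β c) := by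
  have : IsLinearMap ℝ fun q : ℝ × ℝ => α * q.1 + β * q.2 :=
    ⟨fun x y => by simp; ring, fun r x => by simp; ring⟩
  exact convex_halfSpace_le this c

/-- If the vertices of a parallelogram lie in a convex set, so do its points. -/
theorem mem_of_parallelogram {K : Set (ℝ × ℝ)} (hK : Convex ℝ K) {A B C D : ℝ × ℝ} (hA : A ∈ K)
    (hB : B ∈ K) (hC : C ∈ K) (hD : D ∈ K) {s t : ℝ} (hs0 : 0 ≤ s) (hs1 : s ≤ 1) (ht0 : 0 ≤ t)
    (ht1 : t ≤ 1) : (1 - s) • ((1 - t) • A + t • D) + s • ((1 - t) • B + t • C) ∈ K :=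
  hK (hK hA hD (by linarith) ht0 (by ring)) (hK hB hC (by linarith) ht0 (by ring)) (by linarith)
    hs0 (by ring)

theorem convexHull_triangleModel :
    convexHull ℝ {((0, 0) : ℝ × ℝ), (3, 0), (0, 3)} = triangleModel := by
  apply Subset.antisymm
  · refine convexHull_min ?_ ?_
    · rintro q (rfl | rfl | rfl) <;> simp [triangleModel]
    · rw [triangleModel_eq]
      exact (convex_halfPlane _ _ _).inter ((convex_halfPlane _ _ _).inter (convex_halfPlane _ _ _))
  · rintro ⟨x, y⟩ ⟨h1, h2, h3⟩
    simp only at h1 h2 h3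
    have hK := convex_convexHull ℝ {((0, 0) : ℝ × ℝ), (3, 0), (0, 3)}
    have hm : ∀ q ∈ ({((0, 0) : ℝ × ℝ), (3, 0), (0, 3)} : Set (ℝ × ℝ)),
        q ∈ convexHull ℝ {((0, 0) : ℝ × ℝ), (3, 0), (0, 3)} := fun q hq => subset_convexHull ℝ _ hq
    have := hK.sum_mem (t := Finset.univ) (w := ![1 - x / 3 - y / 3, x / 3, y / 3])
      (z := ![(0, 0), (3, 0), (0, 3)])
      (by intro i _; fin_cases i <;> simp <;> linarith) (by simp [Fin.sum_univ_three]; ring)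
      (by intro i _; fin_cases i <;> exact hm _ (by simp))
    convert this using 1
    simp [Fin.sum_univ_three]

theorem convexHull_squareModel :
    convexHull ℝ {((0, 0) : ℝ × ℝ), (2, 0), (2, 2), (0, 2)} = squareModel := by
  apply Subset.antisymm
  · refine convexHull_min ?_ ?_
    · rintro q (rfl | rfl | rfl | rfl) <;> simp [squareModel]
    · have e : squareModel = Icc 0 2 ×ˢ Icc 0 2 := by
        ext ⟨x, y⟩; simp [squareModel, and_assoc, -Icc_prod_Icc]
      rw [e]; exact (convex_Icc _ _).prod (convex_Icc _ _)
  · rintro ⟨x, y⟩ ⟨h1, h2, h3, h4⟩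
    simp only at h1 h2 h3 h4
    have hm : ∀ q ∈ ({((0, 0) : ℝ × ℝ), (2, 0), (2, 2), (0, 2)} : Set (ℝ × ℝ)),
        q ∈ convexHull ℝ {((0, 0) : ℝ × ℝ), (2, 0), (2, 2), (0, 2)} :=
      fun q hq => subset_convexHull ℝ _ hq
    have := mem_of_parallelogram (convex_convexHull ℝ _) (hm (0, 0) (by simp)) (hm (2, 0) (by simp))
      (hm (2, 2) (by simp)) (hm (0, 2) (by simp)) (s := x / 2) (t := y / 2) (by linarith)
      (by linarith) (by linarith) (by linarith)
    convert this using 1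
    ext <;> simp <;> ring

theorem convexHull_hexagonModel :
    convexHull ℝ {((1, 0) : ℝ × ℝ), (1, 1), (0, 1), (-1, 0), (-1, -1), (0, -1)} = hexagonModel := by
  apply Subset.antisymm
  · refine convexHull_min ?_ ?_
    · rintro q (rfl | rfl | rfl | rfl | rfl | rfl) <;> norm_num [hexagonModel]
    · rw [hexagonModel_eq]
      repeat first | exact convex_halfPlane _ _ _ | refine (convex_halfPlane _ _ _).inter ?_
  · rintro ⟨x, y⟩ ⟨h1, h2, h3, h4, h5, h6⟩
    simp only at h1 h2 h3 h4 h5 h6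
    set K := convexHull ℝ {((1, 0) : ℝ × ℝ), (1, 1), (0, 1), (-1, 0), (-1, -1), (0, -1)} with hKdef
    have hK : Convex ℝ K := convex_convexHull ℝ _
    have hm : ∀ q ∈ ({((1, 0) : ℝ × ℝ), (1, 1), (0, 1), (-1, 0), (-1, -1), (0, -1)} : Set (ℝ × ℝ)),
        q ∈ K := fun q hq => subset_convexHull ℝ _ hq
    have h0 : ((0, 0) : ℝ × ℝ) ∈ K := by
      have := hK (hm (1, 0) (by simp)) (hm (-1, 0) (by simp)) (a := 1 / 2) (b := 1 / 2)
        (by norm_num) (by norm_num) (by norm_num)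
      convert this using 1
      simp
    by_cases hp : 0 ≤ x ∧ 0 ≤ y
    · have := mem_of_parallelogram hK h0 (hm (1, 0) (by simp)) (hm (1, 1) (by simp))
        (hm (0, 1) (by simp)) (s := x) (t := y) (by linarith) (by linarith) (by linarith)
            (by linarith)
      convert this using 1
      ext <;> simp; ring
    · by_cases hxy : x ≤ y
      · have : x ≤ 0 := by by_contra hx; exact hp ⟨by linarith, by linarith⟩
        have := mem_of_parallelogram hK h0 (hm (0, 1) (by simp)) (hm (-1, 0) (by simp))
          (hm (-1, -1) (by simp)) (s := y - x) (t := -x) (by linarith) (by linarith) (by linarith)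
          (by linarith)
        convert this using 1
        ext <;> simp <;> ring
      · have : y ≤ 0 := by by_contra hx; exact hp ⟨by linarith, by linarith⟩
        have := mem_of_parallelogram hK h0 (hm (-1, -1) (by simp)) (hm (0, -1) (by simp))
          (hm (1, 0) (by simp)) (s := -y) (t := x - y) (by linarith) (by linarith) (by linarith)
          (by linarith)
        convert this using 1
        ext <;> simp <;> ring

theorem range_fin_three {α : Type*} (f : Fin 3 → α) : range f = {f 0, f 1, f 2} := by
  ext x; simp [Fin.exists_fin_succ, eq_comm]

theorem hasInPlaceDissection_unitPolygon_three : HasInPlaceDissection 6 (unitPolygon 3) := by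
  set ζ := Complex.exp (2 * Real.pi * Complex.I / (3 : ℕ)) with hζ
  have hprim : IsPrimitiveRoot ζ 3 := Complex.isPrimitiveRoot_exp 3 (by norm_num)
  have h1 : 1 + ζ + ζ ^ 2 = 0 := by
    have := hprim.geom_sum_eq_zero (by norm_num)
    simpa [Finset.sum_range_succ] using this
  have him : ζ.im ≠ 0 := by
    intro h0
    have h2 : (ζ.re + 1 / 2) ^ 2 + 3 / 4 = 0 := by
      have := congrArg Complex.re h1
      simp only [Complex.add_re, Complex.one_re, pow_two, Complex.mul_re, h0,
        Complex.zero_re] at this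
      linarith
    nlinarith [sq_nonneg (ζ.re + 1 / 2)]
  obtain ⟨ω, hω⟩ : ∃ ω : Circle, (ω : ℂ) = ζ := ⟨Circle.exp (2 * Real.pi / 3), by
    rw [Circle.coe_exp, hζ]; congr 1; push_cast; ring⟩
  have hI : Indep ((ζ - 1) / 3) ((ζ ^ 2 - 1) / 3) := by
    have h2 : ζ ^ 2 = -1 - ζ := by linear_combination h1
    unfold Indep
    rw [h2]
    have e3 : ∀ z : ℂ, (z / 3).re = z.re / 3 := fun z => by
      rw [show (3 : ℂ) = ((3 : ℝ) : ℂ) by norm_num, Complex.div_ofReal_re]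
    have e4 : ∀ z : ℂ, (z / 3).im = z.im / 3 := fun z => by
      rw [show (3 : ℂ) = ((3 : ℝ) : ℂ) by norm_num, Complex.div_ofReal_im]
    simp only [e3, e4, Complex.sub_re, Complex.sub_im, Complex.neg_re, Complex.neg_im,
      Complex.one_re, Complex.one_im]
    intro h0
    exact him (by linarith)
  have := hasInPlaceDissection_triangle 1 hI ω
    (by rw [hω]; ring) (by rw [hω]; linear_combination (ζ - 1) / 3 * h1)
  convert this using 1
  rw [← convexHull_triangleModel, frame_image_convexHull, unitPolygon, range_fin_three]
  simp only [exp_eq_pow, ← hζ, image_insert_eq, image_singleton, frame]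
  congr 2
  · simp
  · congr 1
    · simp; ring
    · simp; ring

theorem hasInPlaceDissection_unitPolygon_four : HasInPlaceDissection 4 (unitPolygon 4) := by
  have hI : Indep ((Complex.I - 1) / 2) ((-Complex.I - 1) / 2) := by
    unfold Indep
    norm_num
  have := hasInPlaceDissection_square 1 hI
  convert this using 1
  have hζ : Complex.exp (2 * Real.pi * Complex.I / (4 : ℕ)) = Complex.I := by
    refine Eq.trans ?_ Complex.exp_pi_div_two_mul_I
    congr 1; push_cast; ring
  have hr : ∀ f : Fin 4 → ℂ, range f = {f 0, f 1, f 2, f 3} := by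
    intro f; ext x; simp [Fin.exists_fin_succ, eq_comm]
  rw [← convexHull_squareModel, frame_image_convexHull, unitPolygon, hr]
  simp only [exp_eq_pow, hζ, image_insert_eq, image_singleton, frame]
  have e : ∀ x y : ℝ, (1 : ℂ) + x * ((Complex.I - 1) / 2) + y * ((-Complex.I - 1) / 2) =
      1 - (x + y) / 2 + (x - y) / 2 * Complex.I := fun x y => by ring
  have r2 : Complex.I ^ ((2 : Fin 4) : ℕ) = -1 := Complex.I_sq
  have r3 : Complex.I ^ ((3 : Fin 4) : ℕ) = -Complex.I := Complex.I_pow_three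
  rw [e, e, e, e, r2, r3]
  norm_num

theorem hasInPlaceDissection_unitPolygon_six : HasInPlaceDissection 3 (unitPolygon 6) := by
  set ζ := Complex.exp (2 * Real.pi * Complex.I / (6 : ℕ)) with hζ
  have hprim : IsPrimitiveRoot ζ 6 := Complex.isPrimitiveRoot_exp 6 (by norm_num)
  have h3 : ζ ^ 3 = -1 := by
    rw [hζ, ← Complex.exp_nat_mul, ← Complex.exp_pi_mul_I]; congr 1; push_cast; ring
  have h1 : ζ ^ 2 = ζ - 1 := by
    have hne : ζ + 1 ≠ 0 := by
      intro h0
      refine hprim.pow_ne_one_of_pos_of_lt (l := 2) (by norm_num) (by norm_num) ?_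
      rw [show ζ = -1 by linear_combination h0]; norm_num
    apply mul_left_cancel₀ hne
    linear_combination h3
  have him : ζ.im ≠ 0 := by
    intro h0
    have h2 : (ζ.re - 1 / 2) ^ 2 + 3 / 4 = 0 := by
      have := congrArg Complex.re h1
      simp only [Complex.sub_re, Complex.one_re, pow_two, Complex.mul_re, h0] at this
      linarith
    nlinarith [sq_nonneg (ζ.re - 1 / 2)]
  have hI : Indep 1 (ζ ^ 2) := by
    unfold Indep
    rw [h1]
    simpa using him
  have := hasInPlaceDissection_hexagon 0 hI
  convert this using 1
  have hr : ∀ f : Fin 6 → ℂ, range f = {f 0, f 1, f 2, f 3, f 4, f 5} := by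
    intro f; ext x; simp [Fin.exists_fin_succ, eq_comm]
  rw [← convexHull_hexagonModel, frame_image_convexHull, unitPolygon, hr]
  simp only [exp_eq_pow, ← hζ, image_insert_eq, image_singleton, frame]
  have e : ∀ x y : ℝ, (0 : ℂ) + (x : ℂ) * 1 + (y : ℂ) * ζ ^ 2 = x + y * (ζ - 1) := by
    intro x y; rw [h1]; ring
  have h4 : ζ ^ 4 = -ζ := by linear_combination ζ * h3
  have h5 : ζ ^ 5 = 1 - ζ := by linear_combination ζ ^ 2 * h3 - h1
  simp only [e]
  have r0 : ζ ^ ((0 : Fin 6) : ℕ) = 1 := by simp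
  have r1 : ζ ^ ((1 : Fin 6) : ℕ) = ζ := by simp
  have r2 : ζ ^ ((2 : Fin 6) : ℕ) = ζ - 1 := h1
  have r3 : ζ ^ ((3 : Fin 6) : ℕ) = -1 := h3
  have r4 : ζ ^ ((4 : Fin 6) : ℕ) = -ζ := h4
  have r5 : ζ ^ ((5 : Fin 6) : ℕ) = 1 - ζ := h5
  rw [r0, r1, r2, r3, r4, r5]
  congr 2
  · simp
  congr 1
  · simp
  congr 1
  · simp
  congr 1
  · simp
  congr 1
  · simp; ring
  · simp

/-! ### The boundary curve of the regular polygon -/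

/-- The unit vector at angle `π φ / n`. In these units of angle the vertices of the regular `n`-gon
lie at the even integers and the midpoints of its sides at the odd integers. -/
noncomputable def dir (n : ℕ) (φ : ℝ) : ℂ := Complex.exp ((Real.pi * φ / n : ℝ) * Complex.I)

/-- The component of `z` in the direction `dir n φ`. -/
noncomputable def height (n : ℕ) (φ : ℝ) (z : ℂ) : ℝ := (z * dir n (-φ)).re

theorem dir_add (n : ℕ) (φ ψ : ℝ) : dir n (φ + ψ) = dir n φ * dir n ψ := by
  rw [dir, dir, dir, ← Complex.exp_add]; congr 1; push_cast; ring

theorem dir_zero (n : ℕ) : dir n 0 = 1 := by simp [dir]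

theorem dir_mul_dir_neg (n : ℕ) (φ : ℝ) : dir n φ * dir n (-φ) = 1 := by
  rw [← dir_add, add_neg_cancel, dir_zero]

theorem dir_re (n : ℕ) (φ : ℝ) : (dir n φ).re = Real.cos (Real.pi * φ / n) := by
  rw [dir, Complex.exp_ofReal_mul_I_re]

theorem dir_im (n : ℕ) (φ : ℝ) : (dir n φ).im = Real.sin (Real.pi * φ / n) := by
  rw [dir, Complex.exp_ofReal_mul_I_im]

theorem norm_dir (n : ℕ) (φ : ℝ) : ‖dir n φ‖ = 1 := by
  rw [dir, Complex.norm_exp_ofReal_mul_I]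

theorem dir_ne_zero (n : ℕ) (φ : ℝ) : dir n φ ≠ 0 := Complex.exp_ne_zero _

theorem dir_two_mul_self {n : ℕ} (hn : 0 < n) : dir n (2 * n) = 1 := by
  have : (n : ℝ) ≠ 0 := by positivity
  apply Complex.ext
  · rw [dir_re, show Real.pi * (2 * n) / n = 2 * Real.pi by field_simp]; simp
  · rw [dir_im, show Real.pi * (2 * n) / n = 2 * Real.pi by field_simp]; simp

theorem dir_add_two_mul_self {n : ℕ} (hn : 0 < n) (φ : ℝ) : dir n (φ + 2 * n) = dir n φ := by
  rw [dir_add, dir_two_mul_self hn, mul_one]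

theorem dir_one (n : ℕ) :
    dir n 1 = Real.cos (Real.pi / n) + Real.sin (Real.pi / n) * Complex.I := by
  rw [dir, mul_one, Complex.exp_mul_I, Complex.ofReal_cos, Complex.ofReal_sin]

theorem dir_neg_one (n : ℕ) :
    dir n (-1) = Real.cos (Real.pi / n) - Real.sin (Real.pi / n) * Complex.I := by
  rw [dir, show Real.pi * -1 / n = -(Real.pi / n) by ring, Complex.exp_mul_I, ← Complex.ofReal_cos,
    ← Complex.ofReal_sin, Real.cos_neg, Real.sin_neg]
  push_cast; ring

theorem exists_eq_mul_dir {n : ℕ} (hn : 0 < n) (z : ℂ) (hz : z ≠ 0) (a : ℝ) :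
    ∃ ρ φ : ℝ, 0 < ρ ∧ a ≤ φ ∧ φ < a + 2 * n ∧ z = ρ * dir n φ := by
  have hn' : (0 : ℝ) < n := by exact_mod_cast hn
  have hp : (0 : ℝ) < 2 * n := by positivity
  have hper : Function.Periodic (dir n) (2 * n) := dir_add_two_mul_self hn
  refine ⟨‖z‖, toIcoMod hp a (n / Real.pi * z.arg), norm_pos_iff.2 hz,
    (toIcoMod_mem_Ico hp a _).1, (toIcoMod_mem_Ico hp a _).2, ?_⟩
  have e : dir n (toIcoMod hp a (n / Real.pi * z.arg)) = dir n (n / Real.pi * z.arg) := by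
    rw [toIcoMod, hper.sub_zsmul_eq]
  rw [e, dir, show Real.pi * (n / Real.pi * z.arg) / n = z.arg by
    field_simp [Real.pi_ne_zero], Complex.norm_mul_exp_arg_mul_I]

theorem eq_of_mul_dir_eq {n : ℕ} (hn : 0 < n) {ρ ρ' φ φ' : ℝ} (hρ : 0 < ρ) (hρ' : 0 < ρ')
    (h : (ρ : ℂ) * dir n φ = ρ' * dir n φ') (h1 : φ - φ' < 2 * n) (h2 : -(2 * n) < φ - φ') :
    φ = φ' := by
  have hn' : (0 : ℝ) < n := by exact_mod_cast hn
  have hr : ρ = ρ' := by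
    have := congrArg norm h
    simpa [norm_dir, abs_of_pos hρ, abs_of_pos hρ'] using this
  subst hr
  have h3 : dir n φ = dir n φ' := mul_left_cancel₀ (by exact_mod_cast hρ.ne') h
  have h4 : dir n (φ - φ') = 1 := by
    rw [sub_eq_add_neg, dir_add, h3, dir_mul_dir_neg]
  have h5 := dir_re n (φ - φ')
  rw [h4, Complex.one_re] at h5
  have h6 := (Real.cos_eq_one_iff_of_lt_of_lt (x := Real.pi * (φ - φ') / n) (by
    rw [lt_div_iff₀ hn']; nlinarith [Real.pi_pos]) (by
    rw [div_lt_iff₀ hn']; nlinarith [Real.pi_pos])).1 h5.symm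
  have h7 : φ - φ' = 0 := by
    rcases div_eq_zero_iff.1 h6 with h | h
    · exact (mul_eq_zero.1 h).resolve_left Real.pi_ne_zero
    · exact absurd h hn'.ne'
  linarith

theorem height_add (n : ℕ) (φ : ℝ) (x y : ℂ) :
    height n φ (x + y) = height n φ x + height n φ y := by
  simp [height, add_mul]

theorem height_sub (n : ℕ) (φ : ℝ) (x y : ℂ) :
    height n φ (x - y) = height n φ x - height n φ y := by
  simp [height, sub_mul]

theorem height_neg (n : ℕ) (φ : ℝ) (x : ℂ) : height n φ (-x) = -height n φ x := by
  simp [height]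

theorem height_real_mul (n : ℕ) (φ r : ℝ) (x : ℂ) : height n φ (r * x) = r * height n φ x := by
  rw [height, mul_assoc, Complex.re_ofReal_mul, height]

theorem height_zero (n : ℕ) (φ : ℝ) : height n φ 0 = 0 := by simp [height]

theorem height_dir (n : ℕ) (φ ψ : ℝ) : height n φ (dir n ψ) = Real.cos (Real.pi * (ψ - φ) / n) := by
  rw [height, ← dir_add, dir_re]; rfl

theorem height_dir_mul_I (n : ℕ) (φ ψ : ℝ) :
    height n φ (dir n ψ * Complex.I) = Real.sin (Real.pi * (φ - ψ) / n) := by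
  rw [height, mul_right_comm, ← dir_add, Complex.mul_re, Complex.I_re, Complex.I_im, dir_im,
    show Real.pi * (φ - ψ) / n = -(Real.pi * (ψ + -φ) / n) by ring, Real.sin_neg]
  ring

theorem height_le_norm (n : ℕ) (φ : ℝ) (z : ℂ) : height n φ z ≤ ‖z‖ := by
  refine (Complex.re_le_norm _).trans ?_
  rw [norm_mul, norm_dir, mul_one]

/-- The linear relation between the components of a vector in three directions. -/
theorem height_mul_sin (n : ℕ) (α β γ : ℝ) (z : ℂ) :
    height n γ z * Real.sin (Real.pi * (β - α) / n) =
      height n β z * Real.sin (Real.pi * (γ - α) / n) +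
        height n α z * Real.sin (Real.pi * (β - γ) / n) := by
  have e : ∀ φ, height n φ z =
      z.re * Real.cos (Real.pi * φ / n) + z.im * Real.sin (Real.pi * φ / n) := by
    intro φ
    rw [height, Complex.mul_re, dir_re, dir_im, show Real.pi * -φ / n = -(Real.pi * φ / n) by ring,
      Real.cos_neg, Real.sin_neg]; ring
  have s : ∀ φ ψ : ℝ, Real.sin (Real.pi * (φ - ψ) / n) =
      Real.sin (Real.pi * φ / n) * Real.cos (Real.pi * ψ / n) -
        Real.cos (Real.pi * φ / n) * Real.sin (Real.pi * ψ / n) := by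
    intro φ ψ; rw [← Real.sin_sub]; congr 1; ring
  simp only [e, s]
  ring

theorem sin_pos_of_angle {n : ℕ} {x : ℝ} (h0 : 0 < x) (h1 : x < n) :
    0 < Real.sin (Real.pi * x / n) := by
  have hn' : (0 : ℝ) < n := h0.trans h1
  apply Real.sin_pos_of_pos_of_lt_pi
  · have := Real.pi_pos; positivity
  · rw [div_lt_iff₀ hn']; nlinarith [Real.pi_pos]

theorem sin_neg_of_angle {n : ℕ} {x : ℝ} (h0 : x < 0) (h1 : -n < x) :
    Real.sin (Real.pi * x / n) < 0 := by
  have := sin_pos_of_angle (n := n) (x := -x) (by linarith) (by linarith)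
  rw [show Real.pi * -x / n = -(Real.pi * x / n) by ring, Real.sin_neg] at this
  linarith

/-- The angle between a vertex of the polygon and the normal of a side is an odd multiple of `π / n`,
so the vertices lie on the inner side of the line through any side. -/
theorem cos_angle_le {n : ℕ} {d : ℤ} (hd : Odd d) (hn : 0 < n) :
    Real.cos (Real.pi * d / n) ≤ Real.cos (Real.pi / n) := by
  have hn' : (0 : ℝ) < n := by exact_mod_cast hn
  have key : ∀ d : ℤ, 1 ≤ d → d ≤ n → Real.cos (Real.pi * d / n) ≤ Real.cos (Real.pi / n) := by
    intro d h1 h2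
    have h1' : (1 : ℝ) ≤ d := by exact_mod_cast h1
    have h2' : (d : ℝ) ≤ n := by exact_mod_cast h2
    apply Real.cos_le_cos_of_nonneg_of_le_pi
    · have := Real.pi_pos; positivity
    · rw [div_le_iff₀ hn']; nlinarith [Real.pi_pos]
    · apply div_le_div_of_nonneg_right _ hn'.le; nlinarith [Real.pi_pos]
  have hq : Real.cos (Real.pi * d / n) = Real.cos (Real.pi * (d % (2 * n) : ℤ) / n) := by
    have e : (d : ℝ) = (d % (2 * n) : ℤ) + 2 * n * (d / (2 * n) : ℤ) := by
      exact_mod_cast (Int.emod_add_mul_ediv d (2 * n)).symm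
    have : Real.pi * d / n =
        Real.pi * (d % (2 * n) : ℤ) / n + (d / (2 * n) : ℤ) * (2 * Real.pi) := by
      rw [e]; field_simp
    rw [this, Real.cos_add_int_mul_two_pi]
  have hm0 : 0 ≤ d % (2 * n) := Int.emod_nonneg _ (by omega)
  have hm1 : d % (2 * n) < 2 * n := Int.emod_lt_of_pos _ (by omega)
  have hodd : d % (2 * n) ≠ 0 := by
    intro h0
    have h2 : (2 : ℤ) ∣ d := (Dvd.intro _ rfl).trans (Int.dvd_of_emod_eq_zero h0)
    obtain ⟨x, hx⟩ := hd
    omega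
  rw [hq]
  rcases le_total (d % (2 * n)) n with h | h
  · exact key _ (by omega) h
  · have h3 := key (2 * n - d % (2 * n)) (by omega) (by omega)
    have : Real.pi * ((2 * n - d % (2 * n) : ℤ) : ℝ) / n =
        2 * Real.pi - Real.pi * (d % (2 * n) : ℤ) / n := by
      push_cast; field_simp
    rw [this, Real.cos_two_pi_sub] at h3
    exact h3

/-- The odd integer `m` for which `m - 1 ≤ t < m + 1`: the index of the side through `bdry n t`. -/
noncomputable def side (t : ℝ) : ℤ := 2 * ⌊t / 2⌋ + 1

/-- The boundary of the regular `n`-gon with a vertex at `1`, as a closed curve of period `2 * n`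
that runs through each half of a side in one unit of time. -/
noncomputable def bdry (n : ℕ) (t : ℝ) : ℂ :=
  dir n (side t) *
    (Real.cos (Real.pi / n) + ((t - side t) * Real.sin (Real.pi / n) : ℝ) * Complex.I)

theorem odd_side (t : ℝ) : Odd (side t) := ⟨_, rfl⟩

theorem side_sub_one_le (t : ℝ) : (side t : ℝ) - 1 ≤ t := by
  have := Int.floor_le (t / 2)
  rw [side]; push_cast; linarith

theorem lt_side_add_one (t : ℝ) : t < (side t : ℝ) + 1 := by
  have := Int.lt_floor_add_one (t / 2)
  rw [side]; push_cast; linarith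

theorem le_side_of_le {m : ℤ} (hm : Odd m) {t : ℝ} (h : (m : ℝ) - 1 ≤ t) : m ≤ side t := by
  obtain ⟨x, rfl⟩ := hm
  have : x ≤ ⌊t / 2⌋ := Int.le_floor.2 (by push_cast at h; linarith)
  rw [side]; omega

theorem side_le_of_lt {m : ℤ} (hm : Odd m) {t : ℝ} (h : t < (m : ℝ) + 1) : side t ≤ m := by
  obtain ⟨x, rfl⟩ := hm
  have : ⌊t / 2⌋ < x + 1 := Int.floor_lt.2 (by push_cast at h ⊢; linarith)
  rw [side]; omega

/-- The closed formula for `bdry` on one side also holds at the right endpoint. -/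
theorem bdry_eq (n : ℕ) {m : ℤ} (hm : Odd m) {t : ℝ} (h0 : (m : ℝ) - 1 ≤ t) (h1 : t ≤ m + 1) :
    bdry n t = dir n m *
      (Real.cos (Real.pi / n) + ((t - m) * Real.sin (Real.pi / n) : ℝ) * Complex.I) := by
  rcases h1.lt_or_eq with h1 | h1
  · have : side t = m := le_antisymm (side_le_of_lt hm h1) (le_side_of_le hm h0)
    rw [bdry, this]
  · have hs : side t = m + 2 := by
      have ho : Odd (m + 2) := by obtain ⟨x, rfl⟩ := hm; exact ⟨x + 1, by ring⟩
      refine le_antisymm (side_le_of_lt ho ?_) (le_side_of_le ho ?_) <;> push_cast <;> linarith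
    rw [bdry, hs, h1]
    have e1 : (Real.cos (Real.pi / n) : ℂ) +
        (((m : ℝ) + 1 - m) * Real.sin (Real.pi / n) : ℝ) * Complex.I = dir n 1 := by
      rw [dir_one]; push_cast; ring
    have e2 : (Real.cos (Real.pi / n) : ℂ) +
        (((m : ℝ) + 1 - (m + 2 : ℤ)) * Real.sin (Real.pi / n) : ℝ) * Complex.I = dir n (-1) := by
      rw [dir_neg_one]; push_cast; ring
    rw [e1, e2, ← dir_add, ← dir_add]
    congr 1; push_cast; ring

theorem bdry_even (n : ℕ) {i : ℤ} (hi : Even i) : bdry n i = dir n i := by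
  have hm : Odd (i + 1) := hi.add_one
  rw [bdry_eq n hm (by push_cast; linarith) (by push_cast; linarith)]
  have : (Real.cos (Real.pi / n) : ℂ) + (((i : ℝ) - (i + 1 : ℤ)) * Real.sin
      (Real.pi / n) : ℝ) * Complex.I
      = dir n (-1) := by rw [dir_neg_one]; push_cast; ring
  rw [this, ← dir_add]; congr 1; push_cast; ring

theorem bdry_odd (n : ℕ) {i : ℤ} (hi : Odd i) : bdry n i = Real.cos (Real.pi / n) * dir n i := by
  rw [bdry_eq n hi (by linarith) (by linarith)]
  simp [mul_comm]

theorem bdry_add_two_mul_self {n : ℕ} (hn : 0 < n) (t : ℝ) : bdry n (t + 2 * n) = bdry n t := by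
  have hs : side (t + 2 * n) = side t + 2 * n := by
    rw [side, side, show (t + 2 * n) / 2 = t / 2 + (n : ℤ) by push_cast; ring,
      Int.floor_add_intCast]
    ring
  rw [bdry, bdry, hs]
  push_cast
  rw [dir_add_two_mul_self hn]
  congr 3
  ring

theorem bdry_periodic {n : ℕ} (hn : 0 < n) : Function.Periodic (bdry n) (2 * n) :=
  bdry_add_two_mul_self hn

theorem exists_odd_unit_interval (j : ℤ) : ∃ m : ℤ, Odd m ∧ m - 1 ≤ j ∧ j + 1 ≤ m + 1 := by
  rcases Int.even_or_odd j with h | h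
  · exact ⟨j + 1, h.add_one, by omega, by omega⟩
  · exact ⟨j, h, by omega, by omega⟩

theorem bdry_add_eq_lineMap (n : ℕ) (j : ℤ) {s : ℝ} (hs : s ∈ Icc (0 : ℝ) 1) :
    bdry n (j + s) = AffineMap.lineMap (bdry n j) (bdry n (j + 1)) s := by
  obtain ⟨m, hm, h0, h1⟩ := exists_odd_unit_interval j
  have h0' : (m : ℝ) - 1 ≤ j := by exact_mod_cast h0
  have h1' : (j : ℝ) + 1 ≤ m + 1 := by exact_mod_cast h1
  obtain ⟨hs0, hs1⟩ := hs
  rw [bdry_eq n hm (by linarith) (by linarith), bdry_eq n hm (by linarith) (by linarith),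
    bdry_eq n hm (t := j + 1) (by linarith) (by linarith), AffineMap.lineMap_apply]
  simp only [vsub_eq_sub, vadd_eq_add, Complex.real_smul]
  push_cast
  ring

theorem continuous_bdry (n : ℕ) : Continuous (bdry n) := by
  refine continuous_iff_continuousAt.2 fun t => ?_
  have : ∀ m : ℤ, Odd m → ContinuousOn (bdry n) (Icc ((m : ℝ) - 1) (m + 1)) := by
    intro m hm
    refine ContinuousOn.congr (f := fun t : ℝ => dir n m *
      (Real.cos (Real.pi / n) + ((t - m) * Real.sin (Real.pi / n) : ℝ) * Complex.I))
          (by fun_prop) ?_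
    exact fun t ht => bdry_eq n hm ht.1 ht.2
  have h1 : ContinuousOn (bdry n) (Icc ((side t - 2 : ℤ) - 1 : ℝ) ((side t - 2 : ℤ) + 1) ∪
      Icc ((side t : ℝ) - 1) (side t + 1)) := by
    refine ContinuousOn.union_of_isClosed (this _ ?_) (this _
      (odd_side t)) isClosed_Icc isClosed_Icc
    obtain ⟨x, hx⟩ := odd_side t
    exact ⟨x - 1, by rw [hx]; ring⟩
  refine h1.continuousAt ?_
  refine Filter.mem_of_superset (Ioo_mem_nhds (a := (side t : ℝ) - 3) (b := side t + 1)
    (by linarith [side_sub_one_le t]) (lt_side_add_one t)) ?_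
  intro s hs
  rcases le_total s (side t - 1) with h | h
  · left; constructor <;> push_cast <;> linarith [hs.1]
  · right; exact ⟨h, hs.2.le⟩

theorem cos_pi_div_pos {n : ℕ} (hn : 3 ≤ n) : 0 < Real.cos (Real.pi / n) := by
  have hn' : (3 : ℝ) ≤ n := by exact_mod_cast hn
  have hp := Real.pi_pos
  apply Real.cos_pos_of_mem_Ioo
  constructor
  · have : 0 < Real.pi / n := by positivity
    linarith
  · rw [div_lt_div_iff₀ (by linarith) (by norm_num)]; nlinarith

theorem sin_pi_div_pos {n : ℕ} (hn : 3 ≤ n) : 0 < Real.sin (Real.pi / n) := by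
  have hn' : (3 : ℝ) ≤ n := by exact_mod_cast hn
  have := sin_pos_of_angle (n := n) (x := 1) one_pos (by linarith)
  simpa using this

/-- Polar coordinates on a side: `x` is the tangent of the angle from its midpoint. -/
theorem one_add_mul_I_eq (n : ℕ) (hn : 0 < n) (x : ℝ) : (1 : ℂ) + x * Complex.I =
    Real.sqrt (1 + x ^ 2) * dir n (n / Real.pi * Real.arctan x) := by
  have hn' : (n : ℝ) ≠ 0 := by positivity
  have hs : 0 < Real.sqrt (1 + x ^ 2) := by positivity
  have e : Real.pi * (n / Real.pi * Real.arctan x) / n = Real.arctan x := by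
    field_simp [Real.pi_ne_zero]
  apply Complex.ext
  · rw [Complex.re_ofReal_mul, dir_re, e, Real.cos_arctan]; simp; field_simp
  · rw [Complex.im_ofReal_mul, dir_im, e, Real.sin_arctan]; simp; field_simp

/-- The boundary curve in polar coordinates: its angle agrees with the parameter at the integers
and is always in the same order relative to the integers as the parameter. -/
theorem exists_polar {n : ℕ} (hn : 3 ≤ n) (t : ℝ) : ∃ ρ φ : ℝ, 0 < ρ ∧ bdry n t = ρ * dir n φ ∧
    ∀ j : ℤ, ((j : ℝ) < φ ↔ (j : ℝ) < t) ∧ (φ < j ↔ t < j) := by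
  have hn' : (0 : ℝ) < n := by positivity
  have hc := cos_pi_div_pos hn
  have hs := sin_pi_div_pos hn
  have hpi := Real.pi_pos
  have hδ : 0 < Real.pi / n := by positivity
  have hδ2 : Real.pi / n < Real.pi / 2 := by
    have hn' : (3 : ℝ) ≤ n := by exact_mod_cast hn
    rw [div_lt_div_iff₀ (by linarith) (by norm_num)]; nlinarith
  have htan : 0 < Real.tan (Real.pi / n) := by rw [Real.tan_eq_sin_div_cos]; positivity
  have harc : Real.arctan (Real.tan (Real.pi / n)) = Real.pi / n :=
    Real.arctan_tan (by linarith) hδ2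
  set T := Real.tan (Real.pi / n) with hT
  set m := side t with hm
  have h0 := side_sub_one_le t
  have h1 := lt_side_add_one t
  rw [← hm] at h0 h1
  let f : ℝ → ℝ := fun s => n / Real.pi * Real.arctan (s * T)
  have hf : StrictMono f := fun x y hxy =>
    mul_lt_mul_of_pos_left (Real.arctan_strictMono (mul_lt_mul_of_pos_right hxy htan))
        (by positivity)
  have f0 : f 0 = 0 := by simp [f]
  have f1 : f 1 = 1 := by simp only [f, one_mul, harc]; field_simp
  have fm1 : f (-1) = -1 := by
    simp only [f, neg_mul, one_mul, Real.arctan_neg, harc]; field_simp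
  refine ⟨Real.cos (Real.pi / n) * Real.sqrt (1 + ((t - m) * T) ^ 2), m + f (t - m), by positivity,
    ?_, ?_⟩
  · have := one_add_mul_I_eq n (by omega) ((t - m) * T)
    have e : Real.sin (Real.pi / n) = T * Real.cos (Real.pi / n) := by
      rw [hT, Real.tan_mul_cos hc.ne']
    rw [dir_add, bdry, ← hm, e]
    simp only [f, Complex.ofReal_mul] at this ⊢
    linear_combination (dir n m * Real.cos (Real.pi / n)) * this
  · have g0 : 0 < t - m ↔ 0 < f (t - m) := by rw [← f0, hf.lt_iff_lt]; simp [f0]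
    have g1 : t - m < 0 ↔ f (t - m) < 0 := by
      have := hf.lt_iff_lt (a := t - m) (b := 0); rw [f0] at this; exact this.symm
    have g2 : f (t - m) < 1 := by rw [← f1]; exact hf (by linarith)
    have g3 : -1 < t - m ↔ -1 < f (t - m) := by
      have := hf.lt_iff_lt (a := -1) (b := t - m); rw [fm1] at this; exact this.symm
    have g4 : -1 ≤ f (t - m) := by rw [← fm1]; exact hf.monotone (by linarith)
    intro j
    have hj : j ≤ m - 2 ∨ j = m - 1 ∨ j = m ∨ m + 1 ≤ j := by omega
    rcases hj with hj | rfl | rfl | hj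
    · have hj' : (j : ℝ) ≤ m - 2 := by exact_mod_cast hj
      exact ⟨⟨fun _ => by linarith, fun _ => by linarith⟩, fun _ => by linarith,
        fun _ => by linarith⟩
    · push_cast
      refine ⟨⟨fun h => ?_, fun h => ?_⟩, fun h => by linarith, fun h => by linarith⟩
      · have := g3.2 (by linarith); linarith
      · have := g3.1 (by linarith); linarith
    · refine ⟨⟨fun h => ?_, fun h => ?_⟩, fun h => ?_, fun h => ?_⟩
      · have := g0.2 (by linarith); linarith
      · have := g0.1 (by linarith); linarith
      · have := g1.2 (by linarith); linarith
      · have := g1.1 (by linarith); linarith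
    · have hj' : (m : ℝ) + 1 ≤ j := by exact_mod_cast hj
      exact ⟨⟨fun _ => by linarith, fun _ => by linarith⟩, fun _ => by linarith,
        fun _ => by linarith⟩

/-- A period of the boundary curve is injective: points with equal images have equal angle, hence
lie on the same half of a side, on which the curve is affine. -/
theorem injOn_bdry {n : ℕ} (hn : 3 ≤ n) (a : ℤ) : InjOn (bdry n) (Ico (a : ℝ) (a + 2 * n)) := by
  have hn0 : 0 < n := by omega
  intro t ht t' ht' h
  obtain ⟨ρ, φ, hρ, e, hφ⟩ := exists_polar hn t
  obtain ⟨ρ', φ', hρ', e', hφ'⟩ := exists_polar hn t'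
  have b1 : ∀ {t φ : ℝ}, t ∈ Ico (a : ℝ) (a + 2 * n) →
      (∀ j : ℤ, ((j : ℝ) < φ ↔ (j : ℝ) < t) ∧ (φ < j ↔ t < j)) → a ≤ φ ∧ φ < a + 2 * n := by
    intro t φ ht hφ
    refine ⟨not_lt.1 fun h => absurd ((hφ a).2.1 h) (not_lt.2 ht.1), ?_⟩
    have := (hφ (a + 2 * n)).2.2 (by push_cast; exact ht.2)
    push_cast at this; exact this
  obtain ⟨h1, h2⟩ := b1 ht hφ
  obtain ⟨h1', h2'⟩ := b1 ht' hφ'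
  have heq : φ = φ' := eq_of_mul_dir_eq hn0 hρ hρ' (by rw [← e, ← e',
      h]) (by linarith) (by linarith)
  subst heq
  -- Both parameters lie on the same half side, on which the curve is affine.
  have h3 : (⌊t⌋ : ℝ) ≤ t' := by
    refine not_lt.1 fun h => ?_
    exact absurd ((hφ _).2.1 ((hφ' _).2.2 h)) (not_lt.2 (Int.floor_le t))
  have h4 : t' < ⌊t⌋ + 1 := by
    have := (hφ (⌊t⌋ + 1)).2.2 (by push_cast; exact Int.lt_floor_add_one t)
    have := (hφ' (⌊t⌋ + 1)).2.1 this
    push_cast at this; exact this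
  obtain ⟨m, hm, k0, k1⟩ := exists_odd_unit_interval ⌊t⌋
  have k0' : (m : ℝ) - 1 ≤ ⌊t⌋ := by exact_mod_cast k0
  have k1' : (⌊t⌋ : ℝ) + 1 ≤ m + 1 := by exact_mod_cast k1
  have h5 := Int.floor_le t
  have h6 := Int.lt_floor_add_one t
  rw [bdry_eq n hm (by linarith) (by linarith), bdry_eq n hm (by linarith) (by linarith)] at h
  have h7 := mul_left_cancel₀ (dir_ne_zero n m) h
  have h8 := congrArg Complex.im h7
  simp only [Complex.add_im, Complex.ofReal_im, Complex.im_ofReal_mul, Complex.I_im, mul_one,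
    zero_add] at h8
  have := mul_right_cancel₀ (sin_pi_div_pos hn).ne' h8
  linarith

/-- Every ray from the centre meets the boundary curve. -/
theorem exists_eq_mul_bdry {n : ℕ} (hn : 3 ≤ n) (z : ℂ) : ∃ s t : ℝ, 0 ≤ s ∧ z = s * bdry n t := by
  by_cases hz : z = 0
  · exact ⟨0, 0, le_rfl, by simp [hz]⟩
  have hn' : (3 : ℝ) ≤ n := by exact_mod_cast hn
  have hpi := Real.pi_pos
  obtain ⟨ρ, φ, hρ, -, -, rfl⟩ := exists_eq_mul_dir (n := n) (by omega) z hz 0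
  set m := side φ with hm
  have h0 := side_sub_one_le φ
  have h1 := lt_side_add_one φ
  rw [← hm] at h0 h1
  have hc := cos_pi_div_pos hn
  have hs := sin_pi_div_pos hn
  have hδ : 0 < Real.pi / n := by positivity
  have hδ2 : Real.pi / n < Real.pi / 2 := by
    rw [div_lt_div_iff₀ (by linarith) (by norm_num)]; nlinarith
  set x := Real.pi * (φ - m) / n with hx
  have hx0 : -(Real.pi / n) ≤ x := by
    rw [hx, ← neg_div]; apply div_le_div_of_nonneg_right _ (by linarith); nlinarith
  have hx1 : x < Real.pi / n := by
    rw [hx]; apply div_lt_div_of_pos_right _ (by linarith); nlinarith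
  have hcx : 0 < Real.cos x := Real.cos_pos_of_mem_Ioo ⟨by linarith, by linarith⟩
  have htan : 0 < Real.tan (Real.pi / n) := by rw [Real.tan_eq_sin_div_cos]; positivity
  set T := Real.tan (Real.pi / n) with hT
  have ht1 : Real.tan x < T := Real.tan_lt_tan_of_lt_of_lt_pi_div_two (by linarith) hδ2 hx1
  have ht0 : -T ≤ Real.tan x := by
    rw [hT, ← Real.tan_neg]
    exact Real.strictMonoOn_tan.monotoneOn ⟨by linarith, by linarith⟩ ⟨by linarith, by linarith⟩ hx0
  refine ⟨ρ * Real.cos x / Real.cos (Real.pi / n), m + Real.tan x / T, by positivity, ?_⟩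
  rw [bdry_eq n (odd_side φ) (by
      have : -1 ≤ Real.tan x / T := by rw [le_div_iff₀ htan]; linarith
      linarith) (by
      have : Real.tan x / T < 1 := by rw [div_lt_iff₀ htan]; linarith
      linarith), ← hm]
  have e1 : dir n φ = dir n m * dir n (φ - m) := by rw [← dir_add]; congr 1; ring
  have e2 : dir n (φ - m) = Real.cos x + Real.sin x * Complex.I := by
    rw [dir, ← hx, Complex.exp_mul_I, Complex.ofReal_cos, Complex.ofReal_sin]
  have e3 : ((m : ℝ) + Real.tan x / T - m) * Real.sin (Real.pi / n) =
      Real.sin x / Real.cos x * Real.cos (Real.pi / n) := by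
    rw [hT, Real.tan_eq_sin_div_cos x, Real.tan_eq_sin_div_cos (Real.pi / n)]
    field_simp
    ring
  rw [e1, e2, e3]
  have hcx' : (Real.cos x : ℂ) ≠ 0 := by exact_mod_cast hcx.ne'
  have hc' : (Real.cos (Real.pi / n) : ℂ) ≠ 0 := by exact_mod_cast hc.ne'
  simp only [Complex.ofReal_mul, Complex.ofReal_div]
  field_simp

theorem height_bdry_of_mem (n : ℕ) {m : ℤ} (hm : Odd m) {t : ℝ} (h0 : (m : ℝ) - 1 ≤ t)
    (h1 : t ≤ m + 1) : height n m (bdry n t) = Real.cos (Real.pi / n) := by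
  rw [bdry_eq n hm h0 h1, height, mul_right_comm, dir_mul_dir_neg, one_mul, Complex.add_re,
    Complex.ofReal_re, Complex.re_ofReal_mul, Complex.I_re, mul_zero, add_zero]

/-! ### The polygon and its boundary -/

theorem convex_unitPolygon (n : ℕ) : Convex ℝ (unitPolygon n) := convex_convexHull ℝ _

theorem dir_even_mem {n : ℕ} (hn : 0 < n) {i : ℤ} (hi : Even i) : dir n i ∈ unitPolygon n := by
  obtain ⟨x, rfl⟩ := hi
  have hn' : (n : ℝ) ≠ 0 := by positivity
  have hm0 : 0 ≤ x % n := Int.emod_nonneg _ (by omega)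
  have hm1 : x % n < n := Int.emod_lt_of_pos _ (by omega)
  refine subset_convexHull ℝ _ ⟨⟨(x % n).toNat, by omega⟩, ?_⟩
  have e : ((x % n).toNat : ℝ) = (x % n : ℤ) := by exact_mod_cast Int.toNat_of_nonneg hm0
  have e1 : (x : ℝ) = (x % n : ℤ) + n * (x / n : ℤ) := by
    exact_mod_cast (Int.emod_add_mul_ediv x n).symm
  have hper : Function.Periodic (dir n) (2 * n) := dir_add_two_mul_self hn
  have e2 : dir n ((x + x : ℤ) : ℝ) = dir n (2 * (x % n).toNat) := by
    have e3 : ((x + x : ℤ) : ℝ) = 2 * ((x % n : ℤ) : ℝ) + (x / n : ℤ) * (2 * n) := by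
      push_cast at e1 ⊢; linear_combination 2 * e1
    rw [e, e3]
    exact hper.int_mul (x / n) _
  rw [e2, dir]
  refine congrArg Complex.exp ?_
  push_cast; ring

theorem bdry_mem {n : ℕ} (hn : 3 ≤ n) (t : ℝ) : bdry n t ∈ unitPolygon n := by
  have h0 := side_sub_one_le t
  have h1 := lt_side_add_one t
  have ho := odd_side t
  set m := side t with hm
  have he1 : Even (m - 1) := by obtain ⟨x, hx⟩ := ho; exact ⟨x, by omega⟩
  have he2 : Even (m + 1) := ho.add_one
  have := convex_unitPolygon n (dir_even_mem (n := n) (by omega) he1) (dir_even_mem (by omega) he2)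
    (a := (m + 1 - t) / 2) (b := (t - m + 1) / 2) (by linarith) (by linarith) (by ring)
  convert this using 1
  rw [bdry_eq n ho h0 h1.le]
  have e1 : dir n (m - 1 : ℤ) = dir n m * dir n (-1) := by rw [← dir_add]; congr 1; push_cast; ring
  have e2 : dir n (m + 1 : ℤ) = dir n m * dir n 1 := by rw [← dir_add]; congr 1; push_cast; ring
  rw [e1, e2, dir_one, dir_neg_one, Complex.real_smul, Complex.real_smul]
  push_cast
  ring

theorem height_le_of_mem {n : ℕ} (hn : 0 < n) {m : ℤ} (hm : Odd m) {z : ℂ}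
    (hz : z ∈ unitPolygon n) : height n m z ≤ Real.cos (Real.pi / n) := by
  have hc : Convex ℝ {z | height n m z ≤ Real.cos (Real.pi / n)} := by
    have : IsLinearMap ℝ (height n m) := ⟨height_add n m, fun r x => by
      rw [Complex.real_smul, height_real_mul, smul_eq_mul]⟩
    exact convex_halfSpace_le this _
  refine convexHull_min ?_ hc hz
  rintro _ ⟨j, rfl⟩
  have e : Complex.exp (2 * Real.pi * Complex.I * ((j : ℕ) : ℂ) / (n : ℂ)) =
      dir n ((2 * (j : ℕ) : ℤ)) := by
    rw [dir]; congr 1; push_cast; ring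
  simp only [e, mem_ofPred_eq, height_dir]
  have ho : Odd (2 * ((j : ℕ) : ℤ) - m) := by
    obtain ⟨x, hx⟩ := hm; exact ⟨(j : ℕ) - x - 1, by rw [hx]; ring⟩
  have := cos_angle_le ho hn
  rwa [Int.cast_sub] at this

theorem height_bdry_lt {n : ℕ} (hn : 3 ≤ n) {m i : ℤ} (h1 : 1 < |i - m|) (h2 : |i - m| ≤ n) :
    height n m (bdry n i) < Real.cos (Real.pi / n) := by
  have hc := cos_pi_div_pos hn
  have hn' : (0 : ℝ) < n := by positivity
  have hpi := Real.pi_pos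
  have hlt : Real.cos (Real.pi * (i - m) / n) < Real.cos (Real.pi / n) := by
    rw [← Real.cos_abs (Real.pi * (i - m) / n), abs_div, abs_mul, abs_of_pos hpi, abs_of_pos hn']
    have h1' : (1 : ℝ) < |(i : ℝ) - m| := by exact_mod_cast h1
    have h2' : |(i : ℝ) - m| ≤ n := by exact_mod_cast h2
    apply Real.cos_lt_cos_of_nonneg_of_le_pi
    · positivity
    · rw [div_le_iff₀ hn']; nlinarith
    · apply div_lt_div_of_pos_right _ hn'; nlinarith
  rcases Int.even_or_odd i with h | h
  · rw [bdry_even n h, height_dir]; exact hlt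
  · rw [bdry_odd n h, height_real_mul, height_dir]
    nlinarith [Real.cos_le_one (Real.pi / n)]

theorem zero_mem_unitPolygon {n : ℕ} (hn : 3 ≤ n) : (0 : ℂ) ∈ unitPolygon n := by
  have hprim := Complex.isPrimitiveRoot_exp n (by omega)
  have hsum := hprim.geom_sum_eq_zero (by omega)
  have hn' : (n : ℝ) ≠ 0 := by positivity
  have := (convex_convexHull ℝ (range fun j : Fin n =>
    Complex.exp (2 * Real.pi * Complex.I * ((j : ℕ) : ℂ) / (n : ℂ)))).sum_mem
    (t := Finset.univ) (w := fun _ : Fin n => (1 / n : ℝ))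
    (z := fun j : Fin n => Complex.exp (2 * Real.pi * Complex.I * ((j : ℕ) : ℂ) / (n : ℂ)))
    (fun _ _ => by positivity) (by simp [hn']) (fun j _ => subset_convexHull ℝ _ ⟨j, rfl⟩)
  rw [unitPolygon]
  convert this using 1
  rw [← Finset.smul_sum]
  simp only [exp_eq_pow]
  rw [Fin.sum_univ_eq_sum_range (fun j => Complex.exp (2 * Real.pi * Complex.I / n) ^ j) n, hsum,
    smul_zero]

theorem isCompact_unitPolygon (n : ℕ) : IsCompact (unitPolygon n) :=
  (finite_range _).isCompact_convexHull ℝ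

theorem mul_mem_unitPolygon {n : ℕ} (hn : 3 ≤ n) {z : ℂ} (hz : z ∈ unitPolygon n) {s : ℝ}
    (h0 : 0 ≤ s) (h1 : s ≤ 1) : s * z ∈ unitPolygon n := by
  have := convex_unitPolygon n hz (zero_mem_unitPolygon hn) h0 (sub_nonneg.2 h1) (by ring)
  simpa using this

theorem zero_mem_interior {n : ℕ} (hn : 3 ≤ n) : (0 : ℂ) ∈ interior (unitPolygon n) := by
  have hc := cos_pi_div_pos hn
  refine mem_interior.2 ⟨Metric.ball 0 (Real.cos (Real.pi / n)), ?_, Metric.isOpen_ball, by simpa⟩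
  intro z hz
  rw [mem_ball_zero_iff] at hz
  obtain ⟨s, t, hs, rfl⟩ := exists_eq_mul_bdry hn z
  refine mul_mem_unitPolygon hn (bdry_mem hn t) hs ?_
  by_contra h
  have h1 := height_le_norm n (side t) (bdry n t)
  rw [height_bdry_of_mem n (odd_side t) (side_sub_one_le t) (lt_side_add_one t).le] at h1
  rw [norm_mul, Complex.norm_real, Real.norm_of_nonneg hs] at hz
  nlinarith

theorem mul_mem_interior {n : ℕ} (hn : 3 ≤ n) {z : ℂ} (hz : z ∈ unitPolygon n) {s : ℝ}
    (h0 : 0 ≤ s) (h1 : s < 1) : s * z ∈ interior (unitPolygon n) := by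
  have := (convex_unitPolygon n).combo_interior_self_mem_interior (zero_mem_interior hn) hz
    (sub_pos.2 h1) h0 (by ring)
  simpa using this

theorem frontier_unitPolygon {n : ℕ} (hn : 3 ≤ n) : frontier (unitPolygon n) = range (bdry n) := by
  have hc := cos_pi_div_pos hn
  have hcl : IsClosed (unitPolygon n) := (isCompact_unitPolygon n).isClosed
  have hout : ∀ (s t : ℝ), 1 < s → (s : ℂ) * bdry n t ∉ unitPolygon n := by
    intro s t hs h
    have h1 := height_le_of_mem (n := n) (by omega) (odd_side t) h
    rw [height_real_mul,
      height_bdry_of_mem n (odd_side t) (side_sub_one_le t) (lt_side_add_one t).le] at h1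
    nlinarith
  rw [hcl.frontier_eq]
  apply Subset.antisymm
  · rintro z ⟨hz, hz'⟩
    obtain ⟨s, t, hs, rfl⟩ := exists_eq_mul_bdry hn z
    rcases lt_trichotomy s 1 with h | rfl | h
    · exact absurd (mul_mem_interior hn (bdry_mem hn t) hs h) hz'
    · exact ⟨t, by simp⟩
    · exact absurd hz (hout s t h)
  · rintro _ ⟨t, rfl⟩
    refine ⟨bdry_mem hn t, fun h => ?_⟩
    have hcont : Continuous fun s : ℝ => (s : ℂ) * bdry n t := by fun_prop
    have hnhds : (fun s : ℝ => (s : ℂ) * bdry n t) ⁻¹' interior (unitPolygon n) ∈ nhds (1 : ℝ) :=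
      (isOpen_interior.preimage hcont).mem_nhds (by simpa using h)
    obtain ⟨s, hs1, hs2⟩ := Filter.Eventually.exists
      ((Filter.Eventually.filter_mono nhdsWithin_le_nhds hnhds).and
        (self_mem_nhdsWithin : Ioi (1 : ℝ) ∈ nhdsWithin 1 (Ioi 1)))
    exact hout s t hs2 (interior_subset hs1)

theorem bdry_notMem_interior {n : ℕ} (hn : 3 ≤ n) (t : ℝ) :
    bdry n t ∉ interior (unitPolygon n) := by
  have h : bdry n t ∈ frontier (unitPolygon n) := frontier_unitPolygon hn ▸ mem_range_self t
  exact h.2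

/-! ### Open sectors -/

/-- The open sector of directions between `dir n a` and `dir n b`. -/
def sector (n : ℕ) (a b : ℝ) : Set ℂ := {z | ∃ ρ φ : ℝ, 0 < ρ ∧ a < φ ∧ φ < b ∧ z = ρ * dir n φ}

theorem height_add_half_dir {n : ℕ} (hn : 0 < n) (a φ : ℝ) :
    height n (a + n / 2) (dir n φ) = Real.sin (Real.pi * (φ - a) / n) := by
  have hn' : (n : ℝ) ≠ 0 := by positivity
  rw [height_dir, ← Real.cos_sub_pi_div_two]
  congr 1
  field_simp
  ring

theorem height_sub_half_dir {n : ℕ} (hn : 0 < n) (b φ : ℝ) :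
    height n (b - n / 2) (dir n φ) = Real.sin (Real.pi * (b - φ) / n) := by
  have hn' : (n : ℝ) ≠ 0 := by positivity
  rw [height_dir, ← Real.cos_sub_pi_div_two, ← Real.cos_neg]
  congr 1
  field_simp
  ring

theorem mem_sector_of_height {n : ℕ} {a b : ℝ} (hab : a < b) (hba : b < a + n) {z : ℂ}
    (ha : 0 < height n (a + n / 2) z) (hb : 0 < height n (b - n / 2) z) : z ∈ sector n a b := by
  have hn' : (0 : ℝ) < n := by linarith
  have hn : 0 < n := by exact_mod_cast hn'
  have hz : z ≠ 0 := by rintro rfl; simp [height_zero] at ha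
  obtain ⟨ρ, φ, hρ, h1, h2, rfl⟩ := exists_eq_mul_dir hn z hz a
  rw [height_real_mul, height_add_half_dir hn, mul_pos_iff_of_pos_left hρ] at ha
  rw [height_real_mul, height_sub_half_dir hn, mul_pos_iff_of_pos_left hρ] at hb
  have h3 : φ < a + n := by
    by_contra h
    have e : Real.pi * (φ - a) / n = Real.pi * (φ - a - n) / n + Real.pi := by field_simp; ring
    rw [e, Real.sin_add_pi] at ha
    have : 0 ≤ Real.sin (Real.pi * (φ - a - n) / n) := by
      rcases (sub_nonneg.2 (not_lt.1 h)).eq_or_lt with h0 | h0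
      · rw [show φ - a - n = 0 by linarith]; simp
      · exact (sin_pos_of_angle (by linarith) (by linarith)).le
    linarith
  have h4 : a < φ := by
    refine lt_of_le_of_ne h1 ?_
    rintro rfl
    simp at ha
  refine ⟨ρ, φ, hρ, h4, ?_, rfl⟩
  by_contra h
  rcases (not_lt.1 h).eq_or_lt with h0 | h0
  · rw [h0] at hb; simp at hb
  · have := sin_neg_of_angle (n := n) (x := b - φ) (by linarith) (by linarith)
    linarith

theorem disjoint_sector {n : ℕ} (hn : 0 < n) {a b c d : ℝ} (hbc : b ≤ c) (hda : d ≤ a + 2 * n) :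
    Disjoint (sector n a b) (sector n c d) := by
  rw [disjoint_left]
  rintro z ⟨ρ, φ, hρ, h1, h2, rfl⟩ ⟨ρ', φ', hρ', h1', h2', e⟩
  have := eq_of_mul_dir_eq hn hρ hρ' e (by linarith) (by linarith)
  linarith

theorem bdry_mem_sector {n : ℕ} (hn : 3 ≤ n) {a b : ℤ} {t : ℝ} (h1 : (a : ℝ) < t) (h2 : t < b) :
    bdry n t ∈ sector n a b := by
  obtain ⟨ρ, φ, hρ, e, hφ⟩ := exists_polar hn t
  exact ⟨ρ, φ, hρ, (hφ a).1.2 h1, (hφ b).2.2 h2, e⟩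

theorem mem_Ioo_of_bdry_mem_sector {n : ℕ} (hn : 3 ≤ n) {a b : ℤ} (hab : b ≤ a + 2 * n) {t : ℝ}
    (h1 : (a : ℝ) ≤ t) (h2 : t < a + 2 * n) (h : bdry n t ∈ sector n a b) : t ∈ Ioo (a : ℝ) b := by
  obtain ⟨ρ, φ, hρ, e, hφ⟩ := exists_polar hn t
  obtain ⟨ρ', φ', hρ', h3, h4, e'⟩ := h
  have hab' : (b : ℝ) ≤ a + 2 * n := by exact_mod_cast hab
  have h5 : (a : ℝ) ≤ φ := not_lt.1 fun h => absurd ((hφ a).2.1 h) (not_lt.2 h1)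
  have h6 : φ < a + 2 * n := by
    have := (hφ (a + 2 * n)).2.2 (by push_cast; exact h2)
    push_cast at this; exact this
  have := eq_of_mul_dir_eq (by omega) hρ hρ' (e.symm.trans e') (by linarith) (by linarith)
  subst this
  exact ⟨(hφ a).1.1 h3, (hφ b).2.1 h4⟩

theorem eq_zero_of_height_eq_zero {n : ℕ} {α β : ℝ} {y : ℂ} (hα : height n α y = 0)
    (hβ : height n β y = 0) (h1 : α < β) (h2 : β < α + n) : y = 0 := by
  by_contra hy
  have hn' : (0 : ℝ) < n := by linarith
  obtain ⟨ρ, φ, hρ, -, -, e⟩ := exists_eq_mul_dir (n := n) (by exact_mod_cast hn') y hy 0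
  have h3 := height_mul_sin n α β φ y
  rw [hα, hβ, zero_mul, zero_mul, add_zero] at h3
  have h4 := (mul_eq_zero.1 h3).resolve_right (sin_pos_of_angle (by linarith) (by linarith)).ne'
  rw [e, height_real_mul, height_dir] at h4
  simp at h4
  exact hρ.ne' h4

/-- A nonzero vector that points away from direction `α` and towards direction `β` has a positive
component in all directions that lie between `β` and the opposite of `α`. -/
theorem height_pos_of_cone {n : ℕ} {α β γ : ℝ} {y : ℂ} (hα : height n α y ≤ 0)
    (hβ : 0 ≤ height n β y) (hy : y ≠ 0) (h1 : α < β) (h2 : β < γ) (h3 : γ < α + n) :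
    0 < height n γ y := by
  have s1 := sin_pos_of_angle (n := n) (x := β - α) (by linarith) (by linarith)
  have s2 := sin_pos_of_angle (n := n) (x := γ - α) (by linarith) (by linarith)
  have s3 := sin_neg_of_angle (n := n) (x := β - γ) (by linarith) (by linarith)
  have h := height_mul_sin n α β γ y
  have p1 := mul_nonneg hβ s2.le
  have p2 := mul_nonneg_of_nonpos_of_nonpos hα s3.le
  refine lt_of_le_of_ne (nonneg_of_mul_nonneg_left (by linarith) s1) fun h0 => hy ?_
  rw [← h0, zero_mul] at h
  have q1 : height n β y = 0 := (mul_eq_zero.1 (by linarith : _ * _ = (0 : ℝ))).resolve_right s2.ne'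
  have q2 : height n α y = 0 := (mul_eq_zero.1 (by linarith : _ * _ = (0 : ℝ))).resolve_right s3.ne
  exact eq_zero_of_height_eq_zero q2 q1 h1 (by linarith)

theorem height_add_nat {n : ℕ} (hn : 0 < n) (φ : ℝ) (z : ℂ) :
    height n (φ + n) z = -height n φ z := by
  have hn' : (n : ℝ) ≠ 0 := by positivity
  have e : dir n (-(φ + n)) = -dir n (-φ) := by
    rw [neg_add, dir_add]
    have : dir n (-n) = -1 := by
      rw [dir, show Real.pi * -n / n = -Real.pi by field_simp]
      push_cast
      rw [neg_mul, Complex.exp_neg, Complex.exp_pi_mul_I]; norm_num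
    rw [this]; ring
  rw [height, e, height]; simp

/-- The mirror image of `height_pos_of_cone`. -/
theorem height_pos_of_cone' {n : ℕ} {α β γ : ℝ} {y : ℂ} (hα : 0 ≤ height n α y)
    (hβ : height n β y ≤ 0) (hy : y ≠ 0) (h1 : α < β) (h2 : β < γ + n) (h3 : γ < α) :
    0 < height n γ y := by
  have hn : (0 : ℝ) < n := by linarith
  have := height_pos_of_cone (n := n) (α := α) (β := β) (γ := γ + n) (y := -y)
    (by rw [height_neg]; linarith) (by rw [height_neg]; linarith) (neg_ne_zero.2 hy) h1 h2
    (by linarith)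
  rw [height_add_nat (by exact_mod_cast hn), height_neg, neg_neg] at this
  exact this

/-! ### Lenses -/

/-- The arc of the boundary curve of the regular `n`-gon between the times `a` and `b` begins on
the side with index `k`, ends on the side with index `j ≠ k`, and turns by little: the last two
conditions say that the normal of the last side makes an acute angle with the ray through the
starting point, and the normal of the first side one with the ray through the endpoint. -/
structure IsArc (n : ℕ) (a b k j : ℤ) : Prop where
  odd_first : Odd k
  odd_last : Odd j
  start_le : a ≤ k
  le_start : k ≤ a + 1
  le_finish : j ≤ b
  finish_le : b ≤ j + 1
  first_lt_last : k < j
  turn_start : 2 * (j - a) < n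
  turn_finish : 2 * (b - k) < n

/-- The point reflection that exchanges the endpoints of the arc from `a` to `b`. -/
noncomputable def swap (n : ℕ) (a b : ℤ) (z : ℂ) : ℂ := bdry n a + bdry n b - z

/-- The lens cut off by the reflected arc. -/
def lens (n : ℕ) (a b : ℤ) : Set ℂ := unitPolygon n ∩ swap n a b ⁻¹' unitPolygon n

theorem swap_swap (n : ℕ) (a b : ℤ) (z : ℂ) : swap n a b (swap n a b z) = z := by
  simp [swap]

theorem swap_start (n : ℕ) (a b : ℤ) : swap n a b (bdry n a) = bdry n b := by simp [swap]

theorem swap_finish (n : ℕ) (a b : ℤ) : swap n a b (bdry n b) = bdry n a := by simp [swap]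

theorem swap_image_eq_preimage (n : ℕ) (a b : ℤ) (A : Set ℂ) : swap n a b '' A = swap n a b ⁻¹' A :=
  congrFun (image_eq_preimage_of_inverse (swap_swap n a b) (swap_swap n a b)) A

/-- The point reflection `swap`, as a homeomorphism. -/
noncomputable def swapHomeo (n : ℕ) (a b : ℤ) : ℂ ≃ₜ ℂ where
  toFun := swap n a b
  invFun := swap n a b
  left_inv := swap_swap n a b
  right_inv := swap_swap n a b
  continuous_toFun := by unfold swap; fun_prop
  continuous_invFun := by unfold swap; fun_prop

theorem continuous_swap (n : ℕ) (a b : ℤ) : Continuous (swap n a b) := (swapHomeo n a b).continuous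

theorem interior_swap_preimage (n : ℕ) (a b : ℤ) (A : Set ℂ) :
    interior (swap n a b ⁻¹' A) = swap n a b ⁻¹' interior A :=
  ((swapHomeo n a b).preimage_interior A).symm

theorem swap_mem_lens {n : ℕ} {a b : ℤ} {z : ℂ} (hz : z ∈ lens n a b) : swap n a b z ∈ lens n a b :=
  ⟨hz.2, by simpa [swap_swap] using hz.1⟩

theorem swap_image_lens (n : ℕ) (a b : ℤ) : swap n a b '' lens n a b = lens n a b :=
  image_eq_of_leftInverse (fun _ => swap_mem_lens) (fun _ => swap_mem_lens) (swap_swap n a b)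

theorem isClosed_lens (n : ℕ) (a b : ℤ) : IsClosed (lens n a b) :=
  (isCompact_unitPolygon n).isClosed.inter
    ((isCompact_unitPolygon n).isClosed.preimage (continuous_swap n a b))

theorem interior_lens (n : ℕ) (a b : ℤ) : interior (lens n a b) =
    interior (unitPolygon n) ∩ swap n a b ⁻¹' interior (unitPolygon n) := by
  rw [lens, interior_inter, interior_swap_preimage]

theorem exists_bdry_eq_mul_dir {n : ℕ} (hn : 3 ≤ n) (i : ℤ) :
    ∃ r : ℝ, 0 < r ∧ bdry n i = r * dir n i := by
  rcases Int.even_or_odd i with h | h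
  · exact ⟨1, one_pos, by rw [bdry_even n h]; simp⟩
  · exact ⟨_, cos_pi_div_pos hn, bdry_odd n h⟩

theorem height_add_half_bdry {n : ℕ} (hn : 3 ≤ n) (a : ℤ) :
    height n (a + n / 2) (bdry n a) = 0 := by
  obtain ⟨r, hr, e⟩ := exists_bdry_eq_mul_dir hn a
  rw [e, height_real_mul, height_add_half_dir (by omega)]; simp

theorem height_sub_half_bdry {n : ℕ} (hn : 3 ≤ n) (b : ℤ) :
    height n (b - n / 2) (bdry n b) = 0 := by
  obtain ⟨r, hr, e⟩ := exists_bdry_eq_mul_dir hn b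
  rw [e, height_real_mul, height_sub_half_dir (by omega)]; simp

namespace IsArc

variable {n : ℕ} {a b k j : ℤ}

theorem add_two_le (h : IsArc n a b k j) : k + 2 ≤ j := by
  obtain ⟨x, hx⟩ := h.odd_first
  obtain ⟨y, hy⟩ := h.odd_last
  have := h.first_lt_last
  omega

theorem lt (h : IsArc n a b k j) : a < b := by
  have := h.add_two_le; have := h.start_le; have := h.le_finish; omega

theorem sub_lt (h : IsArc n a b k j) (hn : 3 ≤ n) : b - a < n := by
  have := h.turn_start; have := h.finish_le; omega

theorem height_first_start (h : IsArc n a b k j) : height n k (bdry n a) = Real.cos (Real.pi / n) :=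
  height_bdry_of_mem n h.odd_first (by have := h.le_start; exact_mod_cast (by omega : k - 1 ≤ a))
    (by have := h.start_le; exact_mod_cast (by omega : a ≤ k + 1))

theorem height_last_finish (h : IsArc n a b k j) : height n j (bdry n b) = Real.cos (Real.pi / n) :=
  height_bdry_of_mem n h.odd_last (by have := h.le_finish; exact_mod_cast (by omega : j - 1 ≤ b))
    (by exact_mod_cast h.finish_le)

/-- The lens is contained in the sector spanned by its arc, and meets the bounding rays of that
sector in the endpoints of the arc only. -/
theorem mem_lens (h : IsArc n a b k j) (hn : 3 ≤ n) {z : ℂ} (hz : z ∈ lens n a b) :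
    z = bdry n a ∨ z = bdry n b ∨ z ∈ sector n a b := by
  by_cases ha : z = bdry n a
  · exact Or.inl ha
  by_cases hb : z = bdry n b
  · exact Or.inr (Or.inl hb)
  refine Or.inr (Or.inr ?_)
  have hn' : (3 : ℝ) ≤ n := by exact_mod_cast hn
  have h1 : (2 : ℝ) * (j - a) < n := by exact_mod_cast h.turn_start
  have h2 : (2 : ℝ) * (b - k) < n := by exact_mod_cast h.turn_finish
  have h3 : (a : ℝ) ≤ k := by exact_mod_cast h.start_le
  have h4 : (k : ℝ) ≤ a + 1 := by exact_mod_cast h.le_start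
  have h5 : (j : ℝ) ≤ b := by exact_mod_cast h.le_finish
  have h6 : (b : ℝ) ≤ j + 1 := by exact_mod_cast h.finish_le
  have h7 : (k : ℝ) < j := by exact_mod_cast h.first_lt_last
  have h8 : (a : ℝ) < b := by exact_mod_cast h.lt
  have h9 : (b : ℝ) - a < n := by exact_mod_cast h.sub_lt hn
  have zk := height_le_of_mem (by omega) h.odd_first hz.1
  have zj := height_le_of_mem (by omega) h.odd_last hz.1
  have wk := height_le_of_mem (by omega) h.odd_first hz.2
  have wj := height_le_of_mem (by omega) h.odd_last hz.2
  have ek := h.height_first_start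
  have ej := h.height_last_finish
  rw [swap, height_sub, height_add] at wk wj
  apply mem_sector_of_height h8 (by linarith)
  · have := height_pos_of_cone (n := n) (α := k) (β := j) (γ := a + n / 2) (y := z - bdry n a)
      (by rw [height_sub]; linarith) (by rw [height_sub]; linarith) (sub_ne_zero.2 ha) h7
      (by linarith) (by linarith)
    rwa [height_sub, height_add_half_bdry hn, sub_zero] at this
  · have := height_pos_of_cone' (n := n) (α := k) (β := j) (γ := b - n / 2) (y := z - bdry n b)
      (by rw [height_sub]; linarith) (by rw [height_sub]; linarith) (sub_ne_zero.2 hb) h7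
      (by linarith) (by linarith)
    rwa [height_sub, height_sub_half_bdry hn, sub_zero] at this

/-- The interior of an arc is reflected into the interior of the polygon. -/
theorem swap_bdry_mem_interior (h : IsArc n a b k j) (hn : 3 ≤ n) {t : ℝ} (ht : t ∈ Ioo (a : ℝ) b) :
    swap n a b (bdry n t) ∈ interior (unitPolygon n) := by
  obtain ⟨hta, htb⟩ := ht
  have hn0 : 0 < n := by omega
  have hn' : (3 : ℝ) ≤ n := by exact_mod_cast hn
  have h1 : (2 : ℝ) * (j - a) < n := by exact_mod_cast h.turn_start
  have h2 : (2 : ℝ) * (b - k) < n := by exact_mod_cast h.turn_finish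
  have h3 : (a : ℝ) ≤ k := by exact_mod_cast h.start_le
  have h4 : (k : ℝ) ≤ a + 1 := by exact_mod_cast h.le_start
  have h5 : (j : ℝ) ≤ b := by exact_mod_cast h.le_finish
  have h6 : (b : ℝ) ≤ j + 1 := by exact_mod_cast h.finish_le
  have h7 : (k : ℝ) < j := by exact_mod_cast h.first_lt_last
  have h8 : (a : ℝ) < b := by exact_mod_cast h.lt
  have h9 : (b : ℝ) - a < n := by exact_mod_cast h.sub_lt hn
  have hs := sin_pi_div_pos hn
  have hinj := injOn_bdry hn a
  have hta' : t ∈ Ico (a : ℝ) (a + 2 * n) := ⟨hta.le, by linarith⟩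
  have hne_a : bdry n a - bdry n t ≠ 0 := fun e =>
    hta.ne (hinj ⟨le_rfl, by linarith⟩ hta' (sub_eq_zero.1 e))
  have hne_b : bdry n b - bdry n t ≠ 0 := fun e =>
    htb.ne' (hinj ⟨h8.le, by linarith⟩ hta' (sub_eq_zero.1 e))
  -- `m` is the index of the side that contains the given point.
  set m := side t with hm
  have hmo : Odd m := odd_side t
  have m0 : (m : ℝ) - 1 ≤ t := side_sub_one_le t
  have m1 : t < m + 1 := lt_side_add_one t
  have hkm : k ≤ m := le_side_of_le h.odd_first (by linarith)
  have hmj : m ≤ j := side_le_of_lt h.odd_last (by linarith)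
  have hkm' : (k : ℝ) ≤ m := by exact_mod_cast hkm
  have hmj' : (m : ℝ) ≤ j := by exact_mod_cast hmj
  have em : height n m (bdry n t) = Real.cos (Real.pi / n) := height_bdry_of_mem n hmo m0 m1.le
  have amle := height_le_of_mem hn0 hmo (bdry_mem hn a)
  have bmle := height_le_of_mem hn0 hmo (bdry_mem hn b)
  have tj := height_le_of_mem hn0 h.odd_last (bdry_mem hn t)
  have tk := height_le_of_mem hn0 h.odd_first (bdry_mem hn t)
  have ek := h.height_first_start
  have ej := h.height_last_finish
  have hA : 0 < height n (a + n / 2) (bdry n b - bdry n t) := by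
    rcases hmj'.lt_or_eq with hlt | heq
    · exact height_pos_of_cone (α := m) (β := j) (by rw [height_sub]; linarith)
        (by rw [height_sub]; linarith) hne_b hlt (by linarith) (by linarith)
    · have e : bdry n b - bdry n t = ((b - t) * Real.sin (Real.pi / n) : ℝ) *
        (dir n m * Complex.I) := by
        rw [bdry_eq n hmo (t := b) (by linarith) (by linarith), bdry_eq n hmo m0 m1.le]
        push_cast; ring
      rw [e, height_real_mul, height_dir_mul_I]
      exact mul_pos (mul_pos (by linarith) hs) (sin_pos_of_angle (by linarith) (by linarith))
  have hB : 0 < height n (b - n / 2) (bdry n a - bdry n t) := by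
    rcases hkm'.lt_or_eq with hlt | heq
    · exact height_pos_of_cone' (α := k) (β := m) (by rw [height_sub]; linarith)
        (by rw [height_sub]; linarith) hne_a hlt (by linarith) (by linarith)
    · have e : bdry n a - bdry n t = ((a - t) * Real.sin (Real.pi / n) : ℝ) *
        (dir n m * Complex.I) := by
        rw [bdry_eq n hmo (t := a) (by linarith) (by linarith), bdry_eq n hmo m0 m1.le]
        push_cast; ring
      rw [e, height_real_mul, height_dir_mul_I]
      exact mul_pos_of_neg_of_neg (mul_neg_of_neg_of_pos (by linarith) hs)
        (sin_neg_of_angle (by linarith) (by linarith))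
  -- The coordinates of the point with respect to the endpoints of the arc are less than `1`.
  obtain ⟨ρ, φ, hρ, φa, φb, et⟩ := bdry_mem_sector hn hta htb
  have tA : 0 < height n (a + n / 2) (bdry n t) := by
    rw [et, height_real_mul, height_add_half_dir hn0]
    exact mul_pos hρ (sin_pos_of_angle (by linarith) (by linarith))
  have tB : 0 < height n (b - n / 2) (bdry n t) := by
    rw [et, height_real_mul, height_sub_half_dir hn0]
    exact mul_pos hρ (sin_pos_of_angle (by linarith) (by linarith))
  rw [height_sub] at hA hB
  set HA := height n (a + n / 2) (bdry n b) with hHA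
  set HB := height n (b - n / 2) (bdry n a) with hHB
  set α := height n (b - n / 2) (bdry n t) / HB with hα
  set β := height n (a + n / 2) (bdry n t) / HA with hβ
  have hHApos : 0 < HA := by linarith
  have hHBpos : 0 < HB := by linarith
  have α0 : 0 < α := div_pos tB hHBpos
  have β0 : 0 < β := div_pos tA hHApos
  have α1 : α < 1 := (div_lt_one hHBpos).2 (by linarith)
  have β1 : β < 1 := (div_lt_one hHApos).2 (by linarith)
  have hdec : bdry n t = α * bdry n a + β * bdry n b := by
    rw [← sub_eq_zero]
    apply eq_zero_of_height_eq_zero (n := n) (α := b - n / 2) (β := a + n / 2) _ _ (by linarith)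
      (by linarith)
    · rw [height_sub, height_add, height_real_mul, height_real_mul, height_sub_half_bdry hn,
        ← hHB, hα]
      field_simp; ring
    · rw [height_sub, height_add, height_real_mul, height_real_mul, height_add_half_bdry hn,
        ← hHA, hβ]
      field_simp; ring
  -- The endpoints do not lie on a common side, so the point is beyond the chord.
  have hsum : 1 < α + β := by
    have hc := cos_pi_div_pos hn
    have e1 : Real.cos (Real.pi / n) = α * height n m (bdry n a) + β * height n m (bdry n b) := by
      rw [← em, hdec, height_add, height_real_mul, height_real_mul]
    have hlt := h.sub_lt hn
    have hk2 := h.add_two_le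
    have g1 := h.start_le
    have g2 := h.le_finish
    have q : height n m (bdry n a) < Real.cos (Real.pi / n) ∨
        height n m (bdry n b) < Real.cos (Real.pi / n) := by
      rcases hmj.lt_or_eq with hmj2 | hmj2
      · right
        have : m + 2 ≤ j := by
          obtain ⟨x, hx⟩ := hmo; obtain ⟨y, hy⟩ := h.odd_last; omega
        apply height_bdry_lt hn <;> rw [abs_of_nonneg (by omega)] <;> omega
      · left
        apply height_bdry_lt hn <;> rw [abs_of_nonpos (by omega)] <;> omega
    by_contra hle
    have p1 : (α + β) * Real.cos (Real.pi / n) ≤ Real.cos (Real.pi / n) :=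
      mul_le_of_le_one_left hc.le (not_lt.1 hle)
    rw [add_mul] at p1
    rcases q with q | q
    · have p2 := mul_lt_mul_of_pos_left q α0
      have p3 := mul_le_mul_of_nonneg_left bmle β0.le
      linarith
    · have p2 := mul_lt_mul_of_pos_left q β0
      have p3 := mul_le_mul_of_nonneg_left amle α0.le
      linarith
  have hq : (((1 - α) / (2 - α - β) : ℝ) : ℂ) * bdry n a + (((1 - β) /
      (2 - α - β) : ℝ) : ℂ) * bdry n b
      ∈ unitPolygon n := by
    have := convex_unitPolygon n (bdry_mem hn a) (bdry_mem hn b) (a := (1 - α) / (2 - α - β))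
      (b := (1 - β) / (2 - α - β)) (div_nonneg (by linarith) (by linarith))
      (div_nonneg (by linarith) (by linarith))
      (by rw [← add_div, div_eq_one_iff_eq (by linarith : (2 : ℝ) - α - β ≠ 0)]; ring)
    simpa only [Complex.real_smul] using this
  have := mul_mem_interior hn hq (s := 2 - α - β) (by linarith) (by linarith)
  convert this using 1
  have hne : ((2 : ℂ) - α - β) ≠ 0 := by
    have : (2 - α - β : ℝ) ≠ 0 := by linarith
    exact_mod_cast this
  rw [swap, hdec]
  push_cast
  field_simp
  ring

end IsArc

namespace IsArc

variable {n : ℕ} {a b k j : ℤ}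

theorem bdry_mem_lens (h : IsArc n a b k j) (hn : 3 ≤ n) {t : ℝ} (ht : t ∈ Icc (a : ℝ) b) :
    bdry n t ∈ lens n a b := by
  refine ⟨bdry_mem hn t, ?_⟩
  rcases ht.1.eq_or_lt with rfl | h1
  · rw [mem_preimage, swap_start]; exact bdry_mem hn b
  rcases ht.2.eq_or_lt with rfl | h2
  · rw [mem_preimage, swap_finish]; exact bdry_mem hn a
  exact interior_subset (s := unitPolygon n) (h.swap_bdry_mem_interior hn ⟨h1, h2⟩)

theorem mem_arc_of_mem_lens (h : IsArc n a b k j) (hn : 3 ≤ n) {z : ℂ} (hz : z ∈ lens n a b)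
    (hi : z ∉ interior (unitPolygon n)) : z ∈ bdry n '' Icc (a : ℝ) b := by
  have hf : z ∈ frontier (unitPolygon n) := ⟨subset_closure hz.1, hi⟩
  rw [frontier_unitPolygon hn] at hf
  obtain ⟨t, rfl⟩ := hf
  have hab : (a : ℝ) ≤ b := by exact_mod_cast h.lt.le
  rcases h.mem_lens hn hz with e | e | e
  · exact ⟨a, ⟨le_rfl, hab⟩, e.symm⟩
  · exact ⟨b, ⟨hab, le_rfl⟩, e.symm⟩
  have hp : (0 : ℝ) < 2 * n := by positivity
  have e1 : bdry n (toIcoMod hp a t) = bdry n t := by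
    rw [toIcoMod, (bdry_periodic (by omega)).sub_zsmul_eq]
  have hmem := toIcoMod_mem_Ico hp (a : ℝ) t
  rw [← e1] at e ⊢
  have := mem_Ioo_of_bdry_mem_sector hn (by have := h.sub_lt hn; omega) hmem.1 hmem.2 e
  exact ⟨_, Ioo_subset_Icc_self this, rfl⟩

theorem frontier_lens (h : IsArc n a b k j) (hn : 3 ≤ n) : frontier (lens n a b) =
    bdry n '' Icc (a : ℝ) b ∪ swap n a b '' (bdry n '' Icc (a : ℝ) b) := by
  rw [(isClosed_lens n a b).frontier_eq, interior_lens]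
  apply Subset.antisymm
  · rintro z ⟨hz, hi⟩
    by_cases h1 : z ∈ interior (unitPolygon n)
    · right
      rw [swap_image_eq_preimage]
      exact h.mem_arc_of_mem_lens hn (swap_mem_lens hz) fun h2 => hi ⟨h1, h2⟩
    · exact Or.inl (h.mem_arc_of_mem_lens hn hz h1)
  · rintro _ (⟨t, ht, rfl⟩ | ⟨_, ⟨t, ht, rfl⟩, rfl⟩)
    · exact ⟨h.bdry_mem_lens hn ht, fun h1 => bdry_notMem_interior hn t h1.1⟩
    · refine ⟨swap_mem_lens (h.bdry_mem_lens hn ht), fun h1 => bdry_notMem_interior hn t ?_⟩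
      have := h1.2
      rwa [mem_preimage, swap_swap] at this

theorem isPolygonalRegion_lens (h : IsArc n a b k j) (hn : 3 ≤ n) :
    IsPolygonalRegion (lens n a b) := by
  have hlt := h.sub_lt hn
  have h2 : a + 2 ≤ b := by
    have := h.add_two_le; have := h.start_le; have := h.le_finish; omega
  have hab : (a : ℝ) + 2 ≤ b := by exact_mod_cast h2
  have hlt' : (b : ℝ) - a < n := by exact_mod_cast hlt
  refine ⟨(isCompact_unitPolygon n).inter_right
    ((isCompact_unitPolygon n).isClosed.preimage (continuous_swap n a b)), ?_,
        (2 * (b - a)).toNat, ?_⟩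
  · -- The centre of the lens is an interior point.
    have hmid : ((a : ℝ) + b) / 2 ∈ Ioo (a : ℝ) b := ⟨by linarith, by linarith⟩
    have hz := (convex_unitPolygon n).combo_interior_self_mem_interior
      (h.swap_bdry_mem_interior hn hmid) (bdry_mem hn (((a : ℝ) + b) / 2))
      (a := 1 / 2) (b := 1 / 2) (by norm_num) (by norm_num) (by norm_num)
    rw [interior_lens]
    refine ⟨_, hz, ?_⟩
    rw [mem_preimage]
    convert hz using 1
    simp only [swap, Complex.real_smul]
    push_cast
    ring
  · let c : ℝ → ℂ := fun t => if t ≤ b then bdry n t else swap n a b (bdry n (t - (b - a)))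
    have c1 : ∀ t : ℝ, t ≤ b → c t = bdry n t := fun t ht => if_pos ht
    have c2 : ∀ t : ℝ, b ≤ t → c t = swap n a b (bdry n (t - (b - a))) := by
      intro t ht
      rcases ht.eq_or_lt with rfl | ht
      · rw [c1 _ le_rfl, sub_sub_cancel, swap_start]
      · exact if_neg (not_le.2 ht)
    have hN : (((2 * (b - a)).toNat : ℕ) : ℝ) = 2 * (b - a) := by
      have : (((2 * (b - a)).toNat : ℕ) : ℤ) = 2 * (b - a) := Int.toNat_of_nonneg (by omega)
      exact_mod_cast this
    have hinj := injOn_bdry hn a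
    obtain ⟨γ, hs, hb⟩ := exists_simple_polygon_of_curve (N := (2 * (b - a)).toNat) (by omega) c a
      (by
        intro i hi s hs
        rcases lt_or_ge ((a : ℤ) + i) b with hib | hib
        · have hib' : (a : ℝ) + i + 1 ≤ b := by exact_mod_cast hib
          rw [c1 _ (by linarith [hs.2]), c1 _ (by linarith), c1 _ hib']
          have := bdry_add_eq_lineMap n (a + i) hs
          push_cast at this
          exact this
        · have hib' : (b : ℝ) ≤ a + i := by exact_mod_cast hib
          rw [c2 _ (by linarith [hs.1]), c2 _ hib', c2 _ (by linarith)]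
          have := bdry_add_eq_lineMap n (a + i - (b - a)) hs
          push_cast at this
          rw [show (a : ℝ) + i + s - (b - a) = a + i - (b - a) + s by ring, this,
            show (a : ℝ) + i + 1 - (b - a) = a + i - (b - a) + 1 by ring]
          simp only [swap, AffineMap.lineMap_apply, vsub_eq_sub, vadd_eq_add, Complex.real_smul]
          ring)
      (by
        rw [hN, c1 a (by linarith), c2 _ (by linarith),
          show (a : ℝ) + 2 * (b - a) - (b - a) = b by ring, swap_finish])
      (by
        rw [hN]
        -- A point of the reflected arc lies on the arc only if it is an endpoint.
        have key : ∀ t t' : ℝ, t ∈ Ico (a : ℝ) b → t' ∈ Ico (a : ℝ) b →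
            bdry n t ≠ swap n a b (bdry n t') := by
          intro t t' ht ht' e
          rcases ht'.1.eq_or_lt with rfl | h1
          · rw [swap_start] at e
            exact ht.2.ne (hinj ⟨ht.1, by linarith [ht.2]⟩ ⟨by linarith, by linarith⟩ e)
          · exact bdry_notMem_interior hn t (e ▸ h.swap_bdry_mem_interior hn ⟨h1, ht'.2⟩)
        rintro t ⟨ht0, ht1⟩ t' ⟨ht0', ht1'⟩ e
        rcases lt_or_ge t b with h1 | h1 <;> rcases lt_or_ge t' b with h1' | h1'
        · rw [c1 _ h1.le, c1 _ h1'.le] at e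
          exact hinj ⟨ht0, by linarith⟩ ⟨ht0', by linarith⟩ e
        · rw [c1 _ h1.le, c2 _ h1'] at e
          exact absurd e (key _ _ ⟨ht0, h1⟩ ⟨by linarith, by linarith⟩)
        · rw [c2 _ h1, c1 _ h1'.le] at e
          exact absurd e.symm (key _ _ ⟨ht0', h1'⟩ ⟨by linarith, by linarith⟩)
        · rw [c2 _ h1, c2 _ h1'] at e
          have := hinj ⟨by linarith, by linarith⟩ ⟨by linarith, by linarith⟩
            ((swapHomeo n a b).injective e)
          linarith)
    refine ⟨γ, by omega, hs, ?_⟩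
    rw [hb, h.frontier_lens hn, hN]
    ext z
    constructor
    · rintro (⟨t, ht, rfl⟩ | ⟨_, ⟨t, ht, rfl⟩, rfl⟩)
      · exact ⟨t, ⟨ht.1, by linarith [ht.2]⟩, c1 t ht.2⟩
      · refine ⟨t + (b - a), ⟨by linarith [ht.1], by linarith [ht.2]⟩, ?_⟩
        rw [c2 _ (by linarith [ht.1]), add_sub_cancel_right]
    · rintro ⟨t, ht, rfl⟩
      rcases le_total t b with h1 | h1
      · exact Or.inl ⟨t, ⟨ht.1, h1⟩, (c1 t h1).symm⟩
      · exact Or.inr ⟨_, ⟨t - (b - a), ⟨by linarith, by linarith [ht.2]⟩, rfl⟩, (c2 t h1).symm⟩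

/-- When the lens is turned by `π`, its internal cut is carried onto the arc. -/
theorem arc_subset_swap_image (h : IsArc n a b k j) (hn : 3 ≤ n) :
    bdry n '' Icc (a : ℝ) b ⊆ swap n a b '' internalCuts (unitPolygon n) (lens n a b) := by
  rintro _ ⟨t, ht, rfl⟩
  rw [swap_image_eq_preimage, mem_preimage]
  have hab : (a : ℝ) ≠ b := by exact_mod_cast h.lt.ne
  rw [← closure_Ioo hab] at ht
  refine map_mem_closure (f := fun t => swap n a b (bdry n t))
    ((continuous_swap n a b).comp (continuous_bdry n)) ht fun s hs => ?_
  refine ⟨?_, h.swap_bdry_mem_interior hn hs⟩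
  rw [h.frontier_lens hn]
  exact Or.inr ⟨_, ⟨s, Ioo_subset_Icc_self hs, rfl⟩, rfl⟩

end IsArc

/-! ### The central piece -/

/-- The boundary curve of the regular `n`-gon, divided at the times `a 0, …, a l` into `l` arcs. -/
structure IsDivision (n l : ℕ) (a : ℕ → ℤ) : Prop where
  isArc : ∀ i < l, ∃ k j, IsArc n (a i) (a (i + 1)) k j
  closed : a l = a 0 + 2 * n

/-- The interior of the polygon without the lenses. -/
def centralOpen (n l : ℕ) (a : ℕ → ℤ) : Set ℂ :=
  interior (unitPolygon n) \ ⋃ i : Fin l, lens n (a i) (a (i + 1))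

/-- The central piece, bounded by the reflected arcs. -/
def central (n l : ℕ) (a : ℕ → ℤ) : Set ℂ := closure (centralOpen n l a)

/-- The boundary of the central piece: the curve that runs through the reflected arcs. The
reflection of an arc reverses its orientation, hence the sign of `t`. -/
noncomputable def centralCurve (n l : ℕ) (a : ℕ → ℤ) (t : ℝ) : ℂ :=
  let i := Nat.findGreatest (fun i => (a i : ℝ) ≤ t) (l - 1)
  swap n (a i) (a (i + 1)) (bdry n (a i + a (i + 1) - t))

namespace IsDivision

variable {n l : ℕ} {a : ℕ → ℤ}

theorem lt_succ (h : IsDivision n l a) {i : ℕ} (hi : i < l) : a i < a (i + 1) := by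
  obtain ⟨k, j, hA⟩ := h.isArc i hi
  exact hA.lt

theorem le_of_le (h : IsDivision n l a) {i i' : ℕ} (hii : i ≤ i') (hi : i' ≤ l) : a i ≤ a i' := by
  induction i', hii using Nat.le_induction with
  | base => exact le_rfl
  | succ m hm ih => exact (ih (by omega)).trans (h.lt_succ (by omega)).le

theorem le_add (h : IsDivision n l a) {i : ℕ} (hi : i ≤ l) : a i ≤ a 0 + 2 * n :=
  h.closed ▸ h.le_of_le hi le_rfl

theorem exists_mem_Ico (h : IsDivision n l a) {t : ℝ} (ht : t ∈ Ico (a 0 : ℝ) (a 0 + 2 * n)) :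
    ∃ i < l, t ∈ Ico (a i : ℝ) (a (i + 1)) := by
  have key : ∀ m : ℕ, t < a m → ∃ i < m, t ∈ Ico (a i : ℝ) (a (i + 1)) := by
    intro m
    induction m with
    | zero => intro hm; exact absurd ht.1 (not_le.2 hm)
    | succ m ih =>
      intro hm
      rcases lt_or_ge t (a m) with h1 | h1
      · obtain ⟨i, hi, hti⟩ := ih h1
        exact ⟨i, by omega, hti⟩
      · exact ⟨m, by omega, h1, hm⟩
  apply key
  rw [h.closed]
  push_cast
  exact ht.2

theorem centralCurve_eq (h : IsDivision n l a) {i : ℕ} (hi : i < l) {t : ℝ}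
    (ht : t ∈ Icc (a i : ℝ) (a (i + 1))) :
    centralCurve n l a t = swap n (a i) (a (i + 1)) (bdry n (a i + a (i + 1) - t)) := by
  have hidx : ∀ i < l, a i ≤ t → (i + 1 < l → t < a (i + 1)) →
      Nat.findGreatest (fun i => (a i : ℝ) ≤ t) (l - 1) = i := by
    intro i hi h0 h1
    rw [Nat.findGreatest_eq_iff]
    refine ⟨by omega, fun _ => h0, fun m hm hml => not_le.2 ?_⟩
    have h2 : (a (i + 1) : ℝ) ≤ a m := by exact_mod_cast h.le_of_le (by omega) (by omega)
    linarith [h1 (by omega)]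
  by_cases hc : i + 1 < l → t < a (i + 1)
  · rw [centralCurve, hidx i hi ht.1 hc]
  · rw [Classical.not_imp, not_lt] at hc
    obtain ⟨h1, h2⟩ := hc
    have h3 : t = a (i + 1) := le_antisymm ht.2 h2
    have h4 := h.lt_succ h1
    rw [centralCurve, hidx (i + 1) h1 h2 (fun _ => by rw [h3]; exact_mod_cast h4), h3]
    simp only [add_sub_cancel_left, add_sub_cancel_right]
    rw [swap_finish, swap_start]

theorem isOpen_centralOpen : IsOpen (centralOpen n l a) :=
  isOpen_interior.sdiff (isClosed_iUnion_of_finite fun _ => isClosed_lens _ _ _)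

theorem mem_sector_of_mem_lens (h : IsDivision n l a) (hn : 3 ≤ n) {i : ℕ} (hi : i < l) {z : ℂ}
    (hz : z ∈ interior (unitPolygon n)) (hl : z ∈ lens n (a i) (a (i + 1))) :
    z ∈ sector n (a i) (a (i + 1)) := by
  obtain ⟨k, j, hA⟩ := h.isArc i hi
  rcases hA.mem_lens hn hl with rfl | rfl | h1
  · exact absurd hz (bdry_notMem_interior hn _)
  · exact absurd hz (bdry_notMem_interior hn _)
  · exact h1

theorem eq_of_mem_sector (h : IsDivision n l a) (hn : 3 ≤ n) {i i' : ℕ} (hi : i < l) (hi' : i' < l)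
    {z : ℂ} (hz : z ∈ sector n (a i) (a (i + 1))) (hz' : z ∈ sector n (a i') (a (i' + 1))) :
    i = i' := by
  have key : ∀ i i' : ℕ, i < i' → i' < l → z ∈ sector n (a i) (a (i + 1)) →
      z ∉ sector n (a i') (a (i' + 1)) := by
    intro i i' hii hi' h1 h2
    have e1 : (a (i + 1) : ℝ) ≤ a i' := by exact_mod_cast h.le_of_le hii hi'.le
    have e2 : (a (i' + 1) : ℝ) ≤ a i + 2 * n := by
      have := h.le_add (i := i' + 1) hi'
      have h0 := h.le_of_le (Nat.zero_le i) (by omega)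
      exact_mod_cast (by omega : a (i' + 1) ≤ a i + 2 * n)
    exact disjoint_left.1 (disjoint_sector (by omega) e1 e2) h1 h2
  rcases lt_trichotomy i i' with h1 | h1 | h1
  · exact absurd hz' (key _ _ h1 hi' hz)
  · exact h1
  · exact absurd hz (key _ _ h1 hi hz')

theorem exists_mem_arc_of_notMem_interior (h : IsDivision n l a) (hn : 3 ≤ n) {z : ℂ}
    (hz : z ∈ unitPolygon n) (hi : z ∉ interior (unitPolygon n)) :
    ∃ i < l, z ∈ bdry n '' Icc (a i : ℝ) (a (i + 1)) := by
  have hf : z ∈ frontier (unitPolygon n) := ⟨subset_closure hz, hi⟩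
  rw [frontier_unitPolygon hn] at hf
  obtain ⟨t, rfl⟩ := hf
  have hp : (0 : ℝ) < 2 * n := by positivity
  obtain ⟨i, hil, hm⟩ := h.exists_mem_Ico (toIcoMod_mem_Ico hp (a 0 : ℝ) t)
  refine ⟨i, hil, _, Ico_subset_Icc_self hm, ?_⟩
  rw [toIcoMod, (bdry_periodic (by omega)).sub_zsmul_eq]

theorem central_subset : central n l a ⊆ unitPolygon n :=
  closure_minimal (sdiff_subset.trans interior_subset) (isCompact_unitPolygon n).isClosed

theorem disjoint_central (i : Fin l) :
    Disjoint (central n l a) (interior (lens n (a i) (a (i + 1)))) := by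
  refine (Disjoint.closure_left ?_ isOpen_interior)
  rw [disjoint_left]
  intro z hz hz'
  exact hz.2 (mem_iUnion.2 ⟨i, interior_subset hz'⟩)

theorem zero_mem_centralOpen (h : IsDivision n l a) (hn : 3 ≤ n) : (0 : ℂ) ∈ centralOpen n l a := by
  refine ⟨zero_mem_interior hn, fun h0 => ?_⟩
  obtain ⟨i, hi⟩ := mem_iUnion.1 h0
  obtain ⟨ρ, φ, hρ, -, -, e⟩ := h.mem_sector_of_mem_lens hn i.2 (zero_mem_interior hn) hi
  exact mul_ne_zero (by exact_mod_cast hρ.ne') (dir_ne_zero n φ) e.symm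

/-- The reflected arcs are contained in the central piece: near an interior point of a reflected arc
there are points that lie outside of the lens of that arc and are too far from the other lenses. -/
theorem swap_bdry_mem_central (h : IsDivision n l a) (hn : 3 ≤ n) {i : ℕ} (hi : i < l) {t : ℝ}
    (ht : t ∈ Icc (a i : ℝ) (a (i + 1))) :
    swap n (a i) (a (i + 1)) (bdry n t) ∈ central n l a := by
  obtain ⟨k, j, hA⟩ := h.isArc i hi
  have hne : (a i : ℝ) ≠ a (i + 1) := by exact_mod_cast hA.lt.ne
  rw [← closure_Ioo hne] at ht
  rw [central, ← closure_closure]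
  refine map_mem_closure (f := fun t => swap n (a i) (a (i + 1)) (bdry n t))
    ((continuous_swap n _ _).comp (continuous_bdry n)) ht fun s hs => ?_
  have hint := hA.swap_bdry_mem_interior hn hs
  set z := swap n (a i) (a (i + 1)) (bdry n s) with hz
  have hzl : z ∈ lens n (a i) (a (i + 1)) :=
    swap_mem_lens (hA.bdry_mem_lens hn (Ioo_subset_Icc_self hs))
  have hzs := h.mem_sector_of_mem_lens hn hi hint hzl
  -- `z` is a limit of points outside of the reflected polygon.
  have hcl : z ∈ closure (swap n (a i) (a (i + 1)) ⁻¹' (unitPolygon n)ᶜ) := by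
    have e : swap n (a i) (a (i + 1)) z ∈ closure (unitPolygon n)ᶜ := by
      rw [hz, swap_swap]
      have : bdry n s ∈ frontier (unitPolygon n) := frontier_unitPolygon hn ▸ mem_range_self s
      rw [frontier_eq_closure_inter_closure] at this
      exact this.2
    have := (swapHomeo n (a i) (a (i + 1))).preimage_closure (unitPolygon n)ᶜ
    exact this.subset e
  rw [mem_closure_iff] at hcl ⊢
  intro W hW hzW
  have hF : IsClosed (⋃ i' : {i' : Fin l // i'.val ≠ i}, lens n (a i'.1) (a (i'.1 + 1))) :=
    isClosed_iUnion_of_finite fun _ => isClosed_lens _ _ _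
  obtain ⟨y, ⟨⟨hyW, hyI⟩, hyF⟩, hy⟩ := hcl _ ((hW.inter isOpen_interior).inter hF.isOpen_compl)
    ⟨⟨hzW, hint⟩, fun hmem => by
      obtain ⟨⟨i', hi'⟩, hzi⟩ := mem_iUnion.1 hmem
      exact hi' (h.eq_of_mem_sector hn i'.2 hi (h.mem_sector_of_mem_lens hn i'.2 hint hzi) hzs)⟩
  refine ⟨y, hyW, hyI, fun hmem => ?_⟩
  obtain ⟨i', hyi⟩ := mem_iUnion.1 hmem
  by_cases hii : i'.val = i
  · rw [hii] at hyi
    exact hy hyi.2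
  · exact hyF (mem_iUnion.2 ⟨⟨i', hii⟩, hyi⟩)

/-- The reflected arcs contain no interior points of the central piece, since every neighbourhood
of one of their points meets the interior of the lens. -/
theorem swap_bdry_notMem_interior_central (h : IsDivision n l a) (hn : 3 ≤ n) {i : ℕ} (hi : i < l)
    (t : ℝ) : swap n (a i) (a (i + 1)) (bdry n t) ∉ interior (central n l a) := by
  obtain ⟨k, j, hA⟩ := h.isArc i hi
  intro hmem
  have hint := interior_mono central_subset hmem
  -- `z` is a limit of interior points of the lens.
  set z := swap n (a i) (a (i + 1)) (bdry n t) with hz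
  have hcl : z ∈ closure (swap n (a i) (a (i + 1)) ⁻¹' interior (unitPolygon n)) := by
    have e : swap n (a i) (a (i + 1)) z ∈ closure (interior (unitPolygon n)) := by
      rw [hz, swap_swap, (convex_unitPolygon n).closure_interior_eq_closure_of_nonempty_interior
        ⟨0, zero_mem_interior hn⟩]
      exact subset_closure (bdry_mem hn t)
    have := (swapHomeo n (a i) (a (i + 1))).preimage_closure (interior (unitPolygon n))
    exact this.subset e
  obtain ⟨y, ⟨hy1, hy2⟩, hy3⟩ := mem_closure_iff.1 hcl _ (isOpen_interior.inter isOpen_interior)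
    ⟨hmem, hint⟩
  refine disjoint_left.1 (disjoint_central (n := n) (a := a) ⟨i, hi⟩) (interior_subset hy1) ?_
  rw [interior_lens]
  exact ⟨hy2, hy3⟩

theorem frontier_central (h : IsDivision n l a) (hn : 3 ≤ n) :
    frontier (central n l a) = centralCurve n l a '' Icc (a 0 : ℝ) (a 0 + 2 * n) := by
  have hcl : IsClosed (central n l a) := isClosed_closure
  have hsub : ∀ i < l, ∀ t ∈ Icc (a i : ℝ) (a (i + 1)),
      swap n (a i) (a (i + 1)) (bdry n t) ∈
        centralCurve n l a '' Icc (a 0 : ℝ) (a 0 + 2 * n) := by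
    intro i hi t ht
    refine ⟨a i + a (i + 1) - t, ?_, ?_⟩
    · have e1 : (a 0 : ℝ) ≤ a i := by exact_mod_cast h.le_of_le (Nat.zero_le i) hi.le
      have e2 : (a (i + 1) : ℝ) ≤ a 0 + 2 * n := by exact_mod_cast h.le_add hi
      exact ⟨by linarith [ht.2], by linarith [ht.1]⟩
    · rw [h.centralCurve_eq hi ⟨by linarith [ht.2], by linarith [ht.1]⟩, sub_sub_cancel]
  rw [hcl.frontier_eq]
  apply Subset.antisymm
  · rintro z ⟨hz, hzi⟩
    have hzU : z ∉ centralOpen n l a := fun hU =>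
      hzi (interior_maximal subset_closure isOpen_centralOpen hU)
    have hlens : ∃ i < l, z ∈ lens n (a i) (a (i + 1)) := by
      by_cases hint : z ∈ interior (unitPolygon n)
      · by_contra hno
        refine hzU ⟨hint, fun hm => hno ?_⟩
        obtain ⟨i, hi⟩ := mem_iUnion.1 hm
        exact ⟨i, i.2, hi⟩
      · obtain ⟨i, hi, t, ht,
          rfl⟩ := h.exists_mem_arc_of_notMem_interior hn (central_subset hz) hint
        obtain ⟨k, j, hA⟩ := h.isArc i hi
        exact ⟨i, hi, hA.bdry_mem_lens hn ht⟩
    obtain ⟨i, hi, hl⟩ := hlens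
    obtain ⟨k, j, hA⟩ := h.isArc i hi
    have hf : z ∈ frontier (lens n (a i) (a (i + 1))) :=
      ⟨subset_closure hl, disjoint_left.1 (disjoint_central (n := n) (a := a) ⟨i, hi⟩) hz⟩
    have hle : (a i : ℝ) ≤ a (i + 1) := by exact_mod_cast hA.lt.le
    rw [hA.frontier_lens hn] at hf
    rcases hf with ⟨t, ht, rfl⟩ | ⟨_, ⟨t, ht, rfl⟩, rfl⟩
    · rcases ht.1.eq_or_lt with rfl | h1
      · rw [← swap_finish]; exact hsub i hi _ ⟨hle, le_rfl⟩
      rcases ht.2.eq_or_lt with rfl | h2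
      · rw [← swap_start]; exact hsub i hi _ ⟨le_rfl, hle⟩
      -- Near an interior point of the arc there are no points of the central piece.
      exfalso
      have hopen : IsOpen (swap n (a i) (a (i + 1)) ⁻¹' interior (unitPolygon n)) :=
        isOpen_interior.preimage (continuous_swap _ _ _)
      obtain ⟨y, hy1, hy2⟩ := mem_closure_iff.1 hz _ hopen (hA.swap_bdry_mem_interior hn ⟨h1, h2⟩)
      exact hy2.2 (mem_iUnion.2 ⟨⟨i, hi⟩, interior_subset hy2.1,
        interior_subset (s := unitPolygon n) hy1⟩)
    · exact hsub i hi t ht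
  · rintro _ ⟨t, ht, rfl⟩
    have harc : ∃ i < l, t ∈ Icc (a i : ℝ) (a (i + 1)) := by
      rcases ht.2.lt_or_eq with h1 | h1
      · obtain ⟨i, hi, h2⟩ := h.exists_mem_Ico ⟨ht.1, h1⟩
        exact ⟨i, hi, Ico_subset_Icc_self h2⟩
      · have hl : l ≠ 0 := by
          rintro rfl
          have e := h.closed
          omega
        refine ⟨l - 1, by omega, ?_⟩
        have e1 : t = a (l - 1 + 1) := by
          rw [h1, Nat.sub_add_cancel (by omega), h.closed]; push_cast; ring
        have e2 : (a (l - 1) : ℝ) ≤ a (l - 1 + 1) := by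
          exact_mod_cast (h.lt_succ (i := l - 1) (by omega)).le
        rw [e1]
        exact ⟨e2, le_rfl⟩
    obtain ⟨i, hi, hti⟩ := harc
    have hmem : (a i : ℝ) + a (i + 1) - t ∈ Icc (a i : ℝ) (a (i + 1)) :=
      ⟨by linarith [hti.2], by linarith [hti.1]⟩
    rw [h.centralCurve_eq hi hti]
    exact ⟨h.swap_bdry_mem_central hn hi hmem, h.swap_bdry_notMem_interior_central hn hi _⟩

theorem injOn_centralCurve (h : IsDivision n l a) (hn : 3 ≤ n) :
    InjOn (centralCurve n l a) (Ico (a 0 : ℝ) (a 0 + 2 * n)) := by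
  -- The curve passes through the interior of the polygon except at the endpoints of the arcs.
  have key : ∀ t ∈ Ico (a 0 : ℝ) (a 0 + 2 * n), ∃ i < l, t ∈ Ico (a i : ℝ) (a (i + 1)) ∧
      ((t = a i ∧ centralCurve n l a t = bdry n t) ∨
        (centralCurve n l a t ∈ interior (unitPolygon n) ∧
          centralCurve n l a t ∈ sector n (a i) (a (i + 1)))) := by
    intro t ht
    obtain ⟨i, hi, hti⟩ := h.exists_mem_Ico ht
    obtain ⟨k, j, hA⟩ := h.isArc i hi
    refine ⟨i, hi, hti, ?_⟩
    rw [h.centralCurve_eq hi (Ico_subset_Icc_self hti)]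
    rcases hti.1.eq_or_lt with h1 | h1
    · left
      refine ⟨h1.symm, ?_⟩
      rw [← h1, add_sub_cancel_left, swap_finish]
    · right
      have hmem : (a i : ℝ) + a (i + 1) - t ∈ Ioo (a i : ℝ) (a (i + 1)) :=
        ⟨by linarith [hti.2], by linarith⟩
      have hint := hA.swap_bdry_mem_interior hn hmem
      exact ⟨hint, h.mem_sector_of_mem_lens hn hi hint
        (swap_mem_lens (hA.bdry_mem_lens hn (Ioo_subset_Icc_self hmem)))⟩
  intro t ht t' ht' e
  obtain ⟨i, hi, hti, hc⟩ := key t ht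
  obtain ⟨i', hi', hti', hc'⟩ := key t' ht'
  rcases hc with ⟨h1, h2⟩ | ⟨h1, h2⟩ <;> rcases hc' with ⟨h1', h2'⟩ | ⟨h1', h2'⟩
  · rw [h2, h2'] at e
    exact injOn_bdry hn (a 0) ht ht' e
  · rw [← e, h2] at h1'
    exact absurd h1' (bdry_notMem_interior hn _)
  · rw [e, h2'] at h1
    exact absurd h1 (bdry_notMem_interior hn _)
  · rw [← e] at h2'
    obtain rfl := h.eq_of_mem_sector hn hi hi' h2 h2'
    obtain ⟨k, j, hA⟩ := h.isArc i hi
    rw [h.centralCurve_eq hi (Ico_subset_Icc_self hti),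
      h.centralCurve_eq hi (Ico_subset_Icc_self hti')] at e
    have hlt : (a (i + 1) : ℝ) - a i < n := by exact_mod_cast hA.sub_lt hn
    have hn' : (0 : ℝ) < n := by positivity
    have := injOn_bdry hn (a i) ⟨by linarith [hti.2], by linarith [hti.1]⟩
      ⟨by linarith [hti'.2], by linarith [hti'.1]⟩ ((swapHomeo n _ _).injective e)
    linarith

theorem isPolygonalRegion_central (h : IsDivision n l a) (hn : 3 ≤ n) :
    IsPolygonalRegion (central n l a) := by
  have hl : l ≠ 0 := by
    rintro rfl
    have e := h.closed
    omega
  refine ⟨(isCompact_unitPolygon n).of_isClosed_subset isClosed_closure central_subset,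
    ⟨0, interior_maximal subset_closure isOpen_centralOpen (h.zero_mem_centralOpen hn)⟩, 2 * n, ?_⟩
  obtain ⟨γ, hs, hb⟩ := exists_simple_polygon_of_curve (N := 2 * n) (by omega)
      (centralCurve n l a) (a 0)
    (by
      intro m hm s hs
      have hm' : (m : ℝ) < 2 * n := by exact_mod_cast hm
      obtain ⟨i, hi, h1, h2⟩ := h.exists_mem_Ico (t := a 0 + m)
        ⟨by linarith [Nat.cast_nonneg (α := ℝ) m], by linarith⟩
      have h2' : a 0 + m + 1 ≤ a (i + 1) := by exact_mod_cast h2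
      have h3 : (a 0 : ℝ) + m + 1 ≤ a (i + 1) := by exact_mod_cast h2'
      obtain ⟨hs0, hs1⟩ := hs
      rw [h.centralCurve_eq hi ⟨by linarith, by linarith⟩,
        h.centralCurve_eq hi ⟨by linarith, by linarith⟩,
        h.centralCurve_eq hi (t := a 0 + m + 1) ⟨by linarith, by linarith⟩]
      have := bdry_add_eq_lineMap n (a i + a (i + 1) - a 0 - m - 1) (s := 1 - s)
        ⟨by linarith, by linarith⟩
      push_cast at this
      rw [show (a i : ℝ) + a (i + 1) - (a 0 + m + s) = a i + a (i + 1) - a 0 - m - 1 +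
        (1 - s) by ring,
        this, show (a i : ℝ) + a (i + 1) - a 0 - m - 1 + 1 = a i + a (i + 1) - (a 0 + m) by ring,
        show (a i : ℝ) + a (i + 1) - a 0 - m - 1 = a i + a (i + 1) - (a 0 + m + 1) by ring]
      simp only [swap, AffineMap.lineMap_apply, vsub_eq_sub, vadd_eq_add, Complex.real_smul]
      push_cast
      ring)
    (by
      have h0 : (a 0 : ℝ) ≤ a (0 + 1) := by exact_mod_cast (h.lt_succ (i := 0) (by omega)).le
      have h1 : (a (l - 1) : ℝ) ≤ a (l - 1 + 1) := by
        exact_mod_cast (h.lt_succ (i := l - 1) (by omega)).le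
      have e : (a (l - 1 + 1) : ℝ) = a 0 + (2 * n : ℕ) := by
        rw [Nat.sub_add_cancel (by omega), h.closed]; push_cast; ring
      rw [h.centralCurve_eq (i := 0) (by omega) ⟨le_rfl, h0⟩, ← e,
        h.centralCurve_eq (i := l - 1) (by omega) ⟨h1, le_rfl⟩, add_sub_cancel_left,
        add_sub_cancel_right, swap_finish, swap_start, e]
      push_cast
      exact bdry_add_two_mul_self (by omega) _)
    (by
      have := h.injOn_centralCurve hn
      push_cast
      exact this)
  refine ⟨γ, by omega, hs, ?_⟩
  rw [hb, h.frontier_central hn]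
  push_cast
  rfl

/-- The central piece stays where it is, and every lens is rotated by `π` about its centre. -/
theorem hasInPlaceDissection (h : IsDivision n l a) (hn : 3 ≤ n) :
    HasInPlaceDissection (l + 1) (unitPolygon n) := by
  obtain ⟨ε, hε⟩ := exists_circle_eq_neg_one
  have hswap : ∀ i : Fin l, rigidMotion ε (bdry n (a i) + bdry n (a (i + 1))) =
      swap n (a i) (a (i + 1)) := by
    intro i
    funext z
    rw [rigidMotion_apply, hε, swap]; ring
  refine ⟨Fin.cons (central n l a) fun i => lens n (a i) (a (i + 1)), Fin.cons 1 fun _ => ε,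
    Fin.cons 0 fun i => bdry n (a i) + bdry n (a (i + 1)), ?_, ⟨?_, ?_⟩, ?_, ?_⟩
  · intro i
    refine Fin.cases ?_ (fun i => ?_) i
    · exact h.isPolygonalRegion_central hn
    · obtain ⟨k, j, hA⟩ := h.isArc i i.2
      exact hA.isPolygonalRegion_lens hn
  · ext z
    simp only [mem_iUnion, Fin.exists_fin_succ, Fin.cons_zero, Fin.cons_succ]
    constructor
    · rintro (hz | ⟨i, hz⟩)
      · exact central_subset hz
      · exact hz.1
    · intro hz
      by_cases hl : ∃ i : Fin l, z ∈ lens n (a i) (a (i + 1))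
      · exact Or.inr hl
      · left
        by_cases hint : z ∈ interior (unitPolygon n)
        · exact subset_closure ⟨hint, fun hm => hl (mem_iUnion.1 hm)⟩
        · obtain ⟨i, hi, t, ht, rfl⟩ := h.exists_mem_arc_of_notMem_interior hn hz hint
          obtain ⟨k, j, hA⟩ := h.isArc i hi
          exact absurd ⟨⟨i, hi⟩, hA.bdry_mem_lens hn ht⟩ hl
  · have hlens : ∀ i i' : Fin l, i ≠ i' → Disjoint (interior (lens n (a i) (a (i + 1))))
        (interior (lens n (a i') (a (i' + 1)))) := by
      intro i i' hii
      rw [disjoint_left]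
      intro z hz hz'
      have hint : z ∈ interior (unitPolygon n) := by rw [interior_lens] at hz; exact hz.1
      exact hii (Fin.ext (h.eq_of_mem_sector hn i.2 i'.2
        (h.mem_sector_of_mem_lens hn i.2 hint (interior_subset hz))
        (h.mem_sector_of_mem_lens hn i'.2 hint (interior_subset hz'))))
    intro i i'
    refine Fin.cases ?_ (fun i => ?_) i <;> refine Fin.cases ?_ (fun i' => ?_) i' <;> intro hii
    · exact absurd rfl hii
    · exact (disjoint_central i').mono_left interior_subset
    · exact ((disjoint_central i).mono_left interior_subset).symm
    · exact hlens i i' fun e => hii (by rw [e])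
  · intro i
    refine Fin.cases ?_ (fun i => ?_) i
    · simp only [Fin.cons_zero]
      have : rigidMotion 1 0 = id := by funext z; simp [rigidMotion_apply]
      rw [this, image_id]
    · simp only [Fin.cons_succ]
      rw [hswap, swap_image_lens]
  · intro z hz
    have hzP : z ∈ unitPolygon n := (isCompact_unitPolygon n).isClosed.frontier_subset hz
    obtain ⟨i, hi, hzi⟩ := h.exists_mem_arc_of_notMem_interior hn hzP hz.2
    obtain ⟨k, j, hA⟩ := h.isArc i hi
    refine mem_iUnion.2 ⟨(⟨i, hi⟩ : Fin l).succ, ?_⟩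
    simp only [Fin.cons_succ]
    rw [hswap ⟨i, hi⟩]
    exact hA.arc_subset_swap_image hn hzi

end IsDivision

/-! ### Divisions into five arcs -/

/-- For `n = 6` there is no such division, because every arc satisfying the conditions joins the
midpoints of adjacent sides. -/
theorem exists_isDivision {n : ℕ} (hn : 5 ≤ n) (h6 : n ≠ 6) : ∃ a, IsDivision n 5 a := by
  have arc : ∀ {a b : ℤ} (k j : ℤ), (k % 2 = 1 ∧ j % 2 = 1 ∧ a ≤ k ∧ k ≤ a + 1 ∧ j ≤ b ∧
      b ≤ j + 1 ∧ k < j ∧ 2 * (j - a) < n ∧ 2 * (b - k) < n) → ∃ k j, IsArc n a b k j :=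
    fun k j ⟨h1, h2, h3, h4, h5, h6, h7, h8, h9⟩ =>
      ⟨k, j, Int.odd_iff.2 h1, Int.odd_iff.2 h2, h3, h4, h5, h6, h7, h8, h9⟩
  rcases (by omega : n = 5 ∨ n = 7 ∨ n = 8 ∨ n = 9 ∨ 10 ≤ n) with rfl | rfl | rfl | rfl | hn
  · refine ⟨fun i => [1, 3, 5, 7, 9, 11].getD i 0, fun i hi => ?_, by norm_num⟩
    interval_cases i
    · exact arc 1 3 (by norm_num)
    · exact arc 3 5 (by norm_num)
    · exact arc 5 7 (by norm_num)
    · exact arc 7 9 (by norm_num)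
    · exact arc 9 11 (by norm_num)
  · refine ⟨fun i => [1, 4, 7, 10, 13, 15].getD i 0, fun i hi => ?_, by norm_num⟩
    interval_cases i
    · exact arc 1 3 (by norm_num)
    · exact arc 5 7 (by norm_num)
    · exact arc 7 9 (by norm_num)
    · exact arc 11 13 (by norm_num)
    · exact arc 13 15 (by norm_num)
  · refine ⟨fun i => [0, 4, 8, 11, 13, 16].getD i 0, fun i hi => ?_, by norm_num⟩
    interval_cases i
    · exact arc 1 3 (by norm_num)
    · exact arc 5 7 (by norm_num)
    · exact arc 9 11 (by norm_num)
    · exact arc 11 13 (by norm_num)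
    · exact arc 13 15 (by norm_num)
  · refine ⟨fun i => [1, 5, 9, 13, 17, 19].getD i 0, fun i hi => ?_, by norm_num⟩
    interval_cases i
    · exact arc 1 5 (by norm_num)
    · exact arc 5 9 (by norm_num)
    · exact arc 9 13 (by norm_num)
    · exact arc 13 17 (by norm_num)
    · exact arc 17 19 (by norm_num)
  · -- The division points are vertices, spaced as evenly as possible.
    refine ⟨fun i => 2 * ((i * n / 5 : ℕ) : ℤ), fun i hi => ?_, by push_cast; omega⟩
    have h1 : i * n / 5 + 2 ≤ (i + 1) * n / 5 := by rw [add_mul]; omega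
    have h2 : 5 * ((i + 1) * n / 5) ≤ 5 * (i * n / 5) + n + 4 := by rw [add_mul]; omega
    generalize i * n / 5 = p at *
    generalize (i + 1) * n / 5 = q at *
    exact arc (2 * p + 1) (2 * q - 1) (by omega)

end InsideOut

theorem mainTheorem2 (n : ℕ) (P : Set ℂ) (hP : IsRegularPolygon n P) :
    ∃ (k : ℕ) (Q : Fin k → Set ℂ), k ≤ 6 ∧ IsInsideOutDissection P Q := by
  obtain ⟨c, w, hw, rfl⟩ := InsideOut.exists_similarity_of_isRegularPolygon hP
  have key : ∃ k ≤ 6, InsideOut.HasInPlaceDissection k (InsideOut.unitPolygon n) := by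
    have hn : 3 ≤ n := hP.1
    rcases (by omega : n = 3 ∨ n = 4 ∨ n = 6 ∨ 5 ≤ n ∧ n ≠ 6) with rfl | rfl | rfl | ⟨h5, h6⟩
    · exact ⟨6, le_rfl, InsideOut.hasInPlaceDissection_unitPolygon_three⟩
    · exact ⟨4, by norm_num, InsideOut.hasInPlaceDissection_unitPolygon_four⟩
    · exact ⟨3, by norm_num, InsideOut.hasInPlaceDissection_unitPolygon_six⟩
    · obtain ⟨a, ha⟩ := InsideOut.exists_isDivision h5 h6
      exact ⟨6, le_rfl, ha.hasInPlaceDissection hn⟩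
  obtain ⟨k, hk, h⟩ := key
  obtain ⟨Q, hQ⟩ := (h.similarity_image c w hw).exists_isInsideOutDissection
  exact ⟨k, Q, hk, hQ⟩
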